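/- An instance of the budget-constrained minimum cost flow problem consists of a directed multigraph $G=(V,E)$ with $n$ nodes and $m$ edges, a source $s\in V$, a sink $t\in V$, and, for each edge $e$, a capacity $u_e\in\mathbb{N}_{\ge 0}$, a cost $c_e\in\mathbb{Z}$ and a usage fee $b_e\in\mathbb{N}_{\ge 0}$, together with a budget $B\in\mathbb{N}_{\ge 0}$. A feasible $s$-$t$-flow is a vector $x\in\mathbb{R}^E$ with $0\le x_e\le u_e$ for all $e\in E$ and $\sum_{e\in\delta^-(v)}x_e-\sum_{e\in\delta^+(v)}x_e=0$ for all $v\in V\setminus\{s,t\}$. The problem asks for a feasible $s$-$t$-flow that minimizes $\sum_e c_ex_e$ subject to $\sum_e b_ex_e\le B$; the traditional minimum cost flow problem is the same problem without the budget constraint. Optimum solutions are output exactly, as rational vectors. Algorithms are programs on a RAM with integer registers and arrays and unit-cost arithmetic ($+,-,\cdot$, integer division), memory accesses and tests, all of whose numbers remain polynomially bounded in the size of the instance and the absolute values of the numbers in the input; memory that does not hold the input is not initialized. For an algorithm for the traditional minimum cost flow problem, let $\mathrm{MCF}(m,n,C,U)$ be a bound on its running time on instances with $m$ edges, $n$ nodes,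 integral costs of absolute value at most $C\ge 1$ and integral capacities at most $U\ge 1$. Theorem. There are absolute constants $K$ and $\kappa$ such that, for every algorithm for the traditional minimum cost flow problem with running time $\mathrm{MCF}(m,n,C,U)$, there is an algorithm that solves the budget-constrained minimum cost flow problem exactly in time $$K\cdot\log_2 M\cdot \mathrm{MCF}\bigl(m,n,(2nC)^{\kappa},U\bigr)$$ (with $\log_2 M$ rounded down), where $C\ge 1$ is an upper bound on the absolute costs $|c_e|$ and the usage fees $b_e$, $U\ge 1$ is an upper bound on the capacities, and $M\ge 2$ is an upper bound on $C$, $U$, $n$ and $B$. In particular: (a) if the time bound depends on the costs polynomially in $\log (nC)$, in the sense that for every fixed $k$ one has $\mathrm{MCF}(m,n,(2nC)^k,U)\in\mathcal{O}(\mathrm{MCF}(m,n,C,U))$, then this algorithm solves the budget-constrained minimum cost flow problem in time $\mathcal{O}(\log M\cdot \mathrm{MCF}(m,n,C,U))$; (b) if $\mathrm{MCF}(m,n,C,U)$ is polynomial in $m$, $n$, $\log C$ and $\log U$, then this algorithm runs in weakly polynomial time, that is, in time polynomial in $m$, $n$ and $\log M$. -/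

import Mathlib

namespace BudgetFlow

/-! ### Flows -/

/-- A directed multigraph with nodes `Fin n` and edges `Fin m` (parallel edges and loops are
allowed), with integral edge capacities and costs, a source `s` and a sink `t`. -/
structure Network where
  n : ℕ
  m : ℕ
  tail : Fin m → Fin n
  head : Fin m → Fin n
  cap : Fin m → ℕ
  cost : Fin m → ℤ
  s : Fin n
  t : Fin n

namespace Network

/-- Feasible `s`-`t`-flows: conservation at every node other than `s` and `t`, and capacities. -/
def IsFlow (N : Network) (x : Fin N.m → ℝ) : Prop :=
  (∀ v : Fin N.n, v ≠ N.s → v ≠ N.t →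
    (∑ e with N.head e = v, x e) - (∑ e with N.tail e = v, x e) = 0) ∧
  ∀ e, 0 ≤ x e ∧ x e ≤ (N.cap e : ℝ)

/-- The cost `c(x)`. -/
def flowCost (N : Network) (x : Fin N.m → ℝ) : ℝ := ∑ e, (N.cost e : ℝ) * x e

/-- Optimum solutions of the traditional minimum cost flow problem. -/
def IsMinCostFlow (N : Network) (x : Fin N.m → ℝ) : Prop :=
  N.IsFlow x ∧ ∀ y, N.IsFlow y → N.flowCost x ≤ N.flowCost y

end Network

/-- An instance of the budget-constrained minimum cost flow problem. -/
structure BudgetNetwork extends Network where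
  fee : Fin m → ℕ
  budget : ℕ

namespace BudgetNetwork

/-- Feasible solutions: feasible `s`-`t`-flows whose total usage fee is within the budget. -/
def IsFeasible (N : BudgetNetwork) (x : Fin N.m → ℝ) : Prop :=
  N.IsFlow x ∧ ∑ e, (N.fee e : ℝ) * x e ≤ (N.budget : ℝ)

/-- Optimum solutions of the budget-constrained minimum cost flow problem. -/
def IsOptimal (N : BudgetNetwork) (x : Fin N.m → ℝ) : Prop :=
  N.IsFeasible x ∧ ∀ y, N.IsFeasible y → N.flowCost x ≤ N.flowCost y

end BudgetNetwork

/-! ### The machine model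

A word-RAM, programmed in a structured language: integer registers and integer arrays, one unit of
time for each arithmetic operation, memory access or test. The numbers that a run produces have to
fit into a word: they are at most `W` in absolute value, where `W` will be polynomial in the size of
the instance and in the numbers of the input (words of logarithmically many bits). -/

/-- The memory: registers `reg 0, reg 1, …` and arrays `arr 0, arr 1, …`. -/
structure State where
  reg : ℕ → ℤ
  arr : ℕ → ℤ → ℤ

/-- `x := v`. -/
def State.setReg (σ : State) (x : ℕ) (v : ℤ) : State :=
  { σ with reg := Function.update σ.reg x v }

/-- `a[i] := v`. -/
def State.setArr (σ : State) (a : ℕ) (i v : ℤ) : State :=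
  { σ with arr := Function.update σ.arr a (Function.update (σ.arr a) i v) }

/-- The arithmetic operations (`div` is integer division). -/
inductive Op
  | add
  | sub
  | mul
  | div

def Op.eval : Op → ℤ → ℤ → ℤ
  | .add, a, b => a + b
  | .sub, a, b => a - b
  | .mul, a, b => a * b
  | .div, a, b => a / b

/-- Programs. A program is a fixed finite object, the same one for all inputs. -/
inductive Program
  /-- no operation -/
  | nop
  /-- `reg x := a` -/
  | const (x : ℕ) (a : ℤ)
  /-- `reg x := reg y ∘ reg z` -/
  | arith (o : Op) (x y z : ℕ)
  /-- `reg x := arr a [reg i]` -/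
  | load (x a i : ℕ)
  /-- `arr a [reg i] := reg x` -/
  | store (a i x : ℕ)
  /-- `P; Q` -/
  | seq (P Q : Program)
  /-- `if reg x > 0 then P else Q` -/
  | cond (x : ℕ) (P Q : Program)
  /-- `while reg x > 0 do P` -/
  | loop (x : ℕ) (P : Program)

/-- `Exec W P σ σ' τ`: started in `σ`, the program `P` halts in `σ'` after exactly `τ` steps, and
every number written on the way is at most `W` in absolute value. -/
inductive Exec (W : ℕ) : Program → State → State → ℕ → Prop
  | nop (σ : State) : Exec W .nop σ σ 0
  | const (σ : State) (x : ℕ) (a : ℤ) (h : |a| ≤ (W : ℤ)) :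
      Exec W (.const x a) σ (σ.setReg x a) 1
  | arith (σ : State) (o : Op) (x y z : ℕ) (h : |o.eval (σ.reg y) (σ.reg z)| ≤ (W : ℤ)) :
      Exec W (.arith o x y z) σ (σ.setReg x (o.eval (σ.reg y) (σ.reg z))) 1
  | load (σ : State) (x a i : ℕ) (h : |σ.arr a (σ.reg i)| ≤ (W : ℤ)) :
      Exec W (.load x a i) σ (σ.setReg x (σ.arr a (σ.reg i))) 1
  | store (σ : State) (a i x : ℕ) (h : |σ.reg x| ≤ (W : ℤ)) :
      Exec W (.store a i x) σ (σ.setArr a (σ.reg i) (σ.reg x)) 1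
  | seq {P Q : Program} {σ σ' σ'' : State} {τ τ' : ℕ} (h : Exec W P σ σ' τ)
      (h' : Exec W Q σ' σ'' τ') : Exec W (.seq P Q) σ σ'' (τ + τ')
  | condPos {x : ℕ} {P Q : Program} {σ σ' : State} {τ : ℕ} (hx : 0 < σ.reg x)
      (h : Exec W P σ σ' τ) : Exec W (.cond x P Q) σ σ' (τ + 1)
  | condNonpos {x : ℕ} {P Q : Program} {σ σ' : State} {τ : ℕ} (hx : σ.reg x ≤ 0)
      (h : Exec W Q σ σ' τ) : Exec W (.cond x P Q) σ σ' (τ + 1)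
  | loopPos {x : ℕ} {P : Program} {σ σ' σ'' : State} {τ τ' : ℕ} (hx : 0 < σ.reg x)
      (h : Exec W P σ σ' τ) (h' : Exec W (.loop x P) σ' σ'' τ') :
      Exec W (.loop x P) σ σ'' (τ + τ' + 1)
  | loopNonpos {x : ℕ} {P : Program} {σ : State} (hx : σ.reg x ≤ 0) :
      Exec W (.loop x P) σ σ 1

/-! ### Input and output

All memory cells other than the listed ones may hold anything at the start of a run: a program has
to initialise the memory that it uses. -/

/-- The memory holds the network `N`. -/
def Network.StoredIn (N : Network) (σ : State) : Prop :=
  σ.reg 0 = (N.n : ℤ) ∧ σ.reg 1 = (N.m : ℤ) ∧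
  σ.reg 2 = ((N.s : ℕ) : ℤ) ∧ σ.reg 3 = ((N.t : ℕ) : ℤ) ∧
  ∀ e : Fin N.m,
    σ.arr 0 ((e : ℕ) : ℤ) = ((N.tail e : ℕ) : ℤ) ∧
    σ.arr 1 ((e : ℕ) : ℤ) = ((N.head e : ℕ) : ℤ) ∧
    σ.arr 2 ((e : ℕ) : ℤ) = (N.cap e : ℤ) ∧
    σ.arr 3 ((e : ℕ) : ℤ) = N.cost e

/-- The memory holds the instance `N` of the budget-constrained problem. -/
def BudgetNetwork.StoredIn (N : BudgetNetwork) (σ : State) : Prop :=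
  N.toNetwork.StoredIn σ ∧ σ.reg 4 = (N.budget : ℤ) ∧
  ∀ e : Fin N.m, σ.arr 4 ((e : ℕ) : ℤ) = (N.fee e : ℤ)

/-- The memory holds the flow `x` as output: exact rational numbers with the common denominator
`reg 5` and the numerators in `arr 5`. -/
def Outputs {m : ℕ} (σ : State) (x : Fin m → ℝ) : Prop :=
  0 < σ.reg 5 ∧ ∀ e : Fin m, x e = (σ.arr 5 ((e : ℕ) : ℤ) : ℝ) / (σ.reg 5 : ℝ)

/-! ### Solving the two problems within a time bound -/

/-- The program `A` solves the traditional minimum cost flow problem in time `T m n C U`, where `m`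
is the number of edges, `n` the number of nodes, `C ≥ 1` a bound on the absolute values of the costs
and `U ≥ 1` a bound on the capacities, with words of size `(m + n + C + U + 2) ^ w`. -/
def SolvesMCF (A : Program) (w : ℕ) (T : ℕ → ℕ → ℕ → ℕ → ℕ) : Prop :=
  ∀ (N : Network) (C U : ℕ), 1 ≤ C → 1 ≤ U →
    (∀ e, |N.cost e| ≤ (C : ℤ)) → (∀ e, N.cap e ≤ U) →
    ∀ σ : State, N.StoredIn σ →
      ∃ (σ' : State) (τ : ℕ) (x : Fin N.m → ℝ),
        Exec ((N.m + N.n + C + U + 2) ^ w) A σ σ' τ ∧ τ ≤ T N.m N.n C U ∧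
        Outputs σ' x ∧ N.IsMinCostFlow x

/-- The program `P` solves the budget-constrained minimum cost flow problem in time
`time m n C U M`, where `m` is the number of edges, `n` the number of nodes, `C ≥ 1` a bound on the
costs of both kinds (absolute costs and usage fees), `U ≥ 1` a bound on the capacities, and `M ≥ 2`
a bound on all numbers of the input (`n`, costs, usage fees, capacities, and the budget), with words
of size `(m + M) ^ w`. -/
def SolvesBCMCFP (P : Program) (w : ℕ) (time : ℕ → ℕ → ℕ → ℕ → ℕ → ℕ) : Prop :=
  ∀ (N : BudgetNetwork) (C U M : ℕ), 1 ≤ C → 1 ≤ U → 2 ≤ M →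
    (∀ e, |N.cost e| ≤ (C : ℤ)) → (∀ e, N.fee e ≤ C) → (∀ e, N.cap e ≤ U) →
    C ≤ M → U ≤ M → N.n ≤ M → N.budget ≤ M →
    ∀ σ : State, N.StoredIn σ →
      ∃ (σ' : State) (τ : ℕ) (x : Fin N.m → ℝ),
        Exec ((N.m + M) ^ w) P σ σ' τ ∧ τ ≤ time N.m N.n C U M ∧
        Outputs σ' x ∧ N.IsOptimal x

/-- A time bound for minimum cost flows that depends on the costs polynomially in `log (n C)`:
replacing `C` by a power of `2 n C` changes it by a constant factor only. -/
def LogarithmicInCosts (T : ℕ → ℕ → ℕ → ℕ → ℕ) : Prop :=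
  ∀ k : ℕ, ∃ L : ℕ, ∀ m n C U : ℕ, 1 ≤ n → 1 ≤ C → 1 ≤ U →
    T m n ((2 * n * C) ^ k) U ≤ L * T m n C U

/-- A weakly polynomial time bound for minimum cost flows: polynomial in `m`, `n`, `log C` and
`log U`. -/
def WeaklyPolynomial (T : ℕ → ℕ → ℕ → ℕ → ℕ) : Prop :=
  ∃ d : ℕ, ∀ m n C U : ℕ, 1 ≤ n → 1 ≤ C → 1 ≤ U →
    T m n C U ≤ (m + n + Nat.log 2 C + Nat.log 2 U + 2) ^ d

end BudgetFlow

/-!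
The program performs a binary search for the optimal Lagrange multiplier of the budget constraint.
For a multiplier `l ≥ 0`, the Lagrangian relaxation, minimize `c(x) + l * b(x)`, is a traditional
minimum cost flow problem; for `l = k / D` its costs become integral after scaling by `D`.

*Few multipliers matter.* If a flow is optimal for one multiplier but not for another, then one of
its residual cycles becomes negative in between (`IsLagrangeOptimal.exists_cycle`). This uses the
decomposition of a circulation into conformal cycles (`IsCirculation.sum_nonneg_of_conformal`) in
the graph where the sink is merged into the source. A cycle has at most `n` arcs, so the multiplier
at which its cost vanishes is a fraction `p / q` with `|p|, q ≤ n * C`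
(`IsLagrangeOptimal.exists_breakpoint`). Two such fractions differ by at least `1 / (n * C) ^ 2`.
With `N₀ = 2 * n * C` and `D = N₀ ^ 2`, two neighbouring grid points `k / D` thus enclose at most one
of them. All of them lie below `N₀ = N₀ ^ 3 / D`, and for multipliers that large the optimum
solutions have fee zero, like the zero flow. The search over `k ≤ N₀ ^ 3` takes `O(log M)` rounds; a
bound in terms of `n * C` alone is essential, because the number of edges of a multigraph is not
bounded by a function of `M`.

*The end of the search.* Either the multiplier `0` gives a flow within the budget, which is then
optimal, or there are neighbouring multipliers with solutions above and within the budget. Both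
solutions are optimal for a common multiplier (`IsLagrangeOptimal.exists_common`), hence their
convex combination whose fee is exactly the budget is an optimum solution
(`isOptimal_combination`).

*Running time.* Besides the calls of the given program `A`, a round takes `O(m + 1)` steps. These are
paid for by the calls, because every program for minimum cost flows needs more than `m` steps: it has
to overwrite whatever the output cells hold initially (`SolvesMCF.lt_time`).

The program keeps its data in registers and arrays with indices beyond those that `A` writes to. Its
correctness is shown with a small program logic: weakest preconditions for straight-line code
(`runs_of_wp`) and invariants for loops (`runs_loop`, `runs_forLoop`).
-/

namespace BudgetFlow

/-! ### Conformal cycles in circulations -/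

section Circulation

variable {V E R : Type*} [Fintype V] [DecidableEq V] [Fintype E] [Ring R]

/-- The vector `z` is a circulation of the directed multigraph given by `tail` and `head`: flow is
conserved at every node. The entries of `z` may be negative. -/
def IsCirculation (tail head : E → V) (z : E → R) : Prop :=
  ∀ v, ∑ e, ((if head e = v then z e else 0) - (if tail e = v then z e else 0)) = 0

theorem periodicPts_nonempty {α : Type*} [Finite α] [Nonempty α] (f : α → α) :
    (Function.periodicPts f).Nonempty := by
  obtain ⟨x⟩ := ‹Nonempty α›
  obtain ⟨i, j, hij, h⟩ := Finite.exists_ne_map_eq_of_infinite (fun i : ℕ => f^[i] x)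
  wlog hlt : i < j generalizing i j
  · exact this j i hij.symm h.symm (by omega)
  refine ⟨f^[i] x, j - i, by omega, ?_⟩
  simp only [Function.IsPeriodicPt, Function.IsFixedPt] at *
  rw [← Function.iterate_add_apply, Nat.sub_add_cancel hlt.le]
  exact h.symm

/-- A nonzero circulation contains a nonempty union of node-disjoint directed cycles, traversed in
the direction of the flow. Following, from each node with an outgoing arc, one fixed such arc gives
a map on the nodes, and its periodic points span the cycles. -/
theorem exists_conformal_cycle {tail head : E → V} {z : E → ℝ}
    (hz : IsCirculation tail head z) (hne : ∃ e, z e ≠ 0) :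
    ∃ χ : E → ℤ, IsCirculation tail head χ ∧ (∃ e, χ e ≠ 0) ∧
      ∑ e, |χ e| ≤ (Fintype.card V : ℤ) ∧
      ∀ e, χ e ≠ 0 → |χ e| = 1 ∧ 0 < (χ e : ℝ) * z e := by
  classical
  set src : E → V := fun e => if 0 < z e then tail e else head e with hsrc
  set dst : E → V := fun e => if 0 < z e then head e else tail e with hdst
  let Active : V → Prop := fun v => ∃ e, z e ≠ 0 ∧ src e = v
  -- by conservation, a node that is entered by an arc carrying flow is also left by one
  have hact : ∀ e, z e ≠ 0 → Active (dst e) := by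
    intro e he
    by_contra hcon
    have hcon' : ∀ e', src e' = dst e → z e' = 0 := by
      intro e' h'
      by_contra h0
      exact hcon ⟨e', h0, h'⟩
    have hnn : ∀ e', 0 ≤ (if head e' = dst e then z e' else 0)
        - (if tail e' = dst e then z e' else 0) := by
      intro e'
      rcases lt_trichotomy (z e') 0 with h | h | h
      · have h1 : head e' ≠ dst e := fun h1 =>
          h.ne (hcon' e' (by simp only [hsrc]; rw [if_neg (by linarith)]; exact h1))
        rw [if_neg h1]
        split_ifs <;> linarith
      · simp [h]
      · have h1 : tail e' ≠ dst e := fun h1 =>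
          h.ne' (hcon' e' (by simp only [hsrc]; rw [if_pos h]; exact h1))
        rw [if_neg h1]
        split_ifs <;> linarith
    have h0 := (Finset.sum_eq_zero_iff_of_nonneg (fun e' _ => hnn e')).1 (hz (dst e)) e
      (Finset.mem_univ e)
    have hsne : src e ≠ dst e := fun h => he (hcon' e h)
    rcases lt_or_gt_of_ne he with h | h
    · simp only [hsrc, hdst, if_neg (not_lt.2 h.le)] at h0 hsne
      rw [if_neg hsne] at h0
      simp at h0
      exact he h0
    · simp only [hsrc, hdst, if_pos h] at h0 hsne
      rw [if_neg hsne] at h0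
      simp at h0
      exact he h0
  let A := {v : V // Active v}
  have arcEx : ∀ a : A, ∃ e, z e ≠ 0 ∧ src e = a.1 := fun a => a.2
  choose arc harc0 harcsrc using arcEx
  let f : A → A := fun a => ⟨dst (arc a), hact _ (harc0 a)⟩
  obtain ⟨e₀, he₀⟩ := hne
  have : Nonempty A := ⟨⟨dst e₀, hact e₀ he₀⟩⟩
  obtain ⟨a₀, ha₀⟩ := periodicPts_nonempty f
  have hbij := Function.bijOn_periodicPts (f := f)
  set S : Finset A := Finset.univ.filter (· ∈ Function.periodicPts f) with hS
  have hinj : Function.Injective arc := fun a b h => by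
    apply Subtype.ext
    rw [← harcsrc a, ← harcsrc b, h]
  set sgn : E → ℤ := fun e => if 0 < z e then 1 else -1 with hsgn
  set χ : E → ℤ := fun e => if e ∈ S.image arc then sgn e else 0 with hχ
  have hsum : ∀ g : E → ℤ, ∑ e, (if e ∈ S.image arc then g e else 0) = ∑ a ∈ S, g (arc a) := by
    intro g
    rw [← Finset.sum_filter, Finset.filter_mem_eq_inter, Finset.univ_inter,
      Finset.sum_image (fun a _ b _ h => hinj h)]
  refine ⟨χ, ?_, ⟨arc a₀, ?_⟩, ?_, ?_⟩
  · intro v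
    have h1 : ∀ e, ((if head e = v then χ e else 0) - (if tail e = v then χ e else 0))
        = if e ∈ S.image arc then ((if dst e = v then 1 else 0) - (if src e = v then 1 else 0))
          else 0 := by
      intro e
      simp only [hχ, hsgn, hsrc, hdst]
      split_ifs <;> simp
    rw [Finset.sum_congr rfl (fun e _ => h1 e), hsum, Finset.sum_sub_distrib, sub_eq_zero]
    refine Finset.sum_nbij f ?_ ?_ ?_ ?_
    · intro a ha
      rw [hS, Finset.mem_filter] at ha ⊢
      exact ⟨Finset.mem_univ _, hbij.mapsTo ha.2⟩
    · intro a ha b hb h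
      simp only [hS, Finset.coe_filter, Finset.mem_univ, true_and] at ha hb
      exact hbij.injOn ha hb h
    · intro b hb
      simp only [hS, Finset.coe_filter, Finset.mem_univ, true_and] at hb ⊢
      exact hbij.surjOn hb
    · intro a _
      rw [harcsrc (f a)]
  · have : arc a₀ ∈ S.image arc :=
      Finset.mem_image_of_mem _ (Finset.mem_filter.2 ⟨Finset.mem_univ _, ha₀⟩)
    simp only [hχ, if_pos this, hsgn]
    split_ifs <;> simp
  · have h1 : ∀ e, |χ e| = if e ∈ S.image arc then 1 else 0 := by
      intro e
      simp only [hχ, hsgn]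
      split_ifs <;> simp
    rw [Finset.sum_congr rfl (fun e _ => h1 e), hsum (fun _ => 1)]
    simp only [Finset.sum_const, nsmul_eq_mul, mul_one, Nat.cast_le]
    exact (Finset.card_le_univ S).trans (Fintype.card_subtype_le _)
  · intro e he
    have hmem : e ∈ S.image arc := by
      by_contra h
      exact he (by simp only [hχ, if_neg h])
    obtain ⟨a, _, rfl⟩ := Finset.mem_image.1 hmem
    simp only [hχ, if_pos hmem, hsgn]
    have hz0 := harc0 a
    split_ifs with h
    · simpa using h
    · have : z (arc a) < 0 := lt_of_le_of_ne (not_lt.1 h) hz0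
      simpa using this

theorem exists_pos_le_conformal {z : E → ℝ} {χ : E → ℤ} (hne : ∃ e, χ e ≠ 0)
    (hχ : ∀ e, χ e ≠ 0 → |χ e| = 1 ∧ 0 < (χ e : ℝ) * z e) :
    ∃ ε : ℝ, 0 < ε ∧ (∀ e, χ e ≠ 0 → ε ≤ χ e * z e) ∧ ∃ e, χ e ≠ 0 ∧ ε = χ e * z e := by
  classical
  obtain ⟨e, he, hmin⟩ := Finset.exists_min_image (Finset.univ.filter (fun e => χ e ≠ 0))
    (fun e => (χ e : ℝ) * z e) (by simpa [Finset.Nonempty] using hne)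
  have he' := (Finset.mem_filter.1 he).2
  exact ⟨_, (hχ e he').2, fun e' h => hmin e' (Finset.mem_filter.2 ⟨Finset.mem_univ _, h⟩),
    e, he', rfl⟩

/-- A linear functional that is nonnegative on all conformal cycles of a circulation is nonnegative
on the circulation: cycles can be subtracted until nothing is left. -/
theorem IsCirculation.sum_nonneg_of_conformal {tail head : E → V} (w : E → ℝ) {z : E → ℝ}
    (hz : IsCirculation tail head z)
    (h : ∀ χ : E → ℤ, IsCirculation tail head χ → (∃ e, χ e ≠ 0) →
      ∑ e, |χ e| ≤ (Fintype.card V : ℤ) →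
      (∀ e, χ e ≠ 0 → |χ e| = 1 ∧ 0 < (χ e : ℝ) * z e) → 0 ≤ ∑ e, w e * (χ e : ℝ)) :
    0 ≤ ∑ e, w e * z e := by
  classical
  induction hc : (Finset.univ.filter (fun e => z e ≠ 0)).card using Nat.strong_induction_on
    generalizing z with
  | _ c ih =>
  by_cases hne : ∃ e, z e ≠ 0
  swap
  · push Not at hne
    simp [hne]
  obtain ⟨χ, hχc, hχne, hχs, hχz⟩ := exists_conformal_cycle hz hne
  obtain ⟨ε, hε, hmin, e₀, he₀, hεe⟩ := exists_pos_le_conformal hχne hχz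
  set z' : E → ℝ := fun e => z e - ε * χ e with hz'
  -- the remaining circulation is conformal with the original one
  have hconf : ∀ e, ∀ a : ℤ, |a| = 1 → 0 < (a : ℝ) * z' e → 0 < (a : ℝ) * z e := by
    intro e a ha hpos
    simp only [hz'] at hpos
    by_cases h0 : χ e = 0
    · simpa [h0] using hpos
    obtain ⟨h1, h2⟩ := hχz e h0
    have h3 := hmin e h0
    rcases (abs_eq (by norm_num : (0 : ℤ) ≤ 1)).1 ha with rfl | rfl <;>
    rcases (abs_eq (by norm_num : (0 : ℤ) ≤ 1)).1 h1 with h4 | h4 <;>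
    rw [h4] at h2 h3 hpos <;> push_cast at * <;> linarith
  have hcirc : IsCirculation tail head z' := by
    intro v
    have h1 := hz v
    have h2 := congrArg (fun a : ℤ => (a : ℝ)) (hχc v)
    push_cast at h2
    have h3 : ∀ e, ((if head e = v then z' e else 0) - (if tail e = v then z' e else 0))
      = ((if head e = v then z e else 0) - (if tail e = v then z e else 0))
        - ε * ((if head e = v then (χ e : ℝ) else 0) - (if tail e = v then (χ e : ℝ) else 0)) := by
      intro e
      simp only [hz']
      split_ifs <;> ring
    rw [Finset.sum_congr rfl (fun e _ => h3 e), Finset.sum_sub_distrib, ← Finset.mul_sum, h1]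
    have h4 : ∑ e, ((if head e = v then (χ e : ℝ) else 0) - (if tail e = v then (χ e : ℝ) else 0))
      = 0 := h2
    rw [h4]
    ring
  have hsub : ∀ e, z' e ≠ 0 → z e ≠ 0 := by
    intro e he h0
    apply he
    have : χ e = 0 := by
      by_contra h1
      have := (hχz e h1).2
      simp [h0] at this
    simp [hz', h0, this]
  have hlt : (Finset.univ.filter (fun e => z' e ≠ 0)).card < c := by
    rw [← hc]
    apply Finset.card_lt_card
    rw [Finset.ssubset_iff_of_subset]
    · refine ⟨e₀, ?_, ?_⟩
      · simp only [Finset.mem_filter, Finset.mem_univ, true_and]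
        intro h0
        have := (hχz e₀ he₀).2
        simp [h0] at this
      · simp only [Finset.mem_filter, Finset.mem_univ, true_and, not_not, hz', hεe]
        rcases (abs_eq (by norm_num : (0 : ℤ) ≤ 1)).1 (hχz e₀ he₀).1 with h4 | h4 <;>
          rw [h4] <;> push_cast <;> ring
    · intro e
      simpa using hsub e
  have h1 := ih _ hlt hcirc (fun χ' a b c d => h χ' a b c (fun e he =>
    ⟨(d e he).1, hconf e _ (d e he).1 (d e he).2⟩)) rfl
  have h2 := h χ hχc hχne hχs hχz
  have h3 : ∑ e, w e * z e = ∑ e, w e * z' e + ε * ∑ e, w e * (χ e : ℝ) := by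
    rw [Finset.mul_sum, ← Finset.sum_add_distrib]
    exact Finset.sum_congr rfl (fun e _ => by simp only [hz']; ring)
  rw [h3]
  positivity

end Circulation

/-! ### The Lagrangian relaxation of the budget constraint -/

namespace Network

/-- The node map that merges the sink into the source. It turns `s`-`t`-flows into circulations. -/
def merge (N : Network) (v : Fin N.n) : Fin N.n := if v = N.t then N.s else v

theorem merge_eq_iff (N : Network) {v : Fin N.n} (hs : v ≠ N.s) (ht : v ≠ N.t) (u : Fin N.n) :
    N.merge u = v ↔ u = v := by
  unfold merge
  split_ifs with h
  · exact ⟨fun h' => absurd h'.symm hs, fun h' => absurd (h'.symm.trans h) ht⟩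
  · rfl

/-- Conservation at the source follows from conservation at the other nodes. -/
theorem IsFlow.isCirculation {N : Network} {x : Fin N.m → ℝ} (hx : N.IsFlow x) :
    IsCirculation (fun e => N.merge (N.tail e)) (fun e => N.merge (N.head e)) x := by
  have hother : ∀ v, v ≠ N.s → ∑ e, ((if N.merge (N.head e) = v then x e else 0)
      - (if N.merge (N.tail e) = v then x e else 0)) = 0 := by
    intro v hs
    by_cases ht : v = N.t
    · have hne : ∀ u, N.merge u ≠ v := by
        intro u hu
        unfold merge at hu
        split_ifs at hu with h
        · exact hs hu.symm
        · exact h (hu.trans ht)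
      simp [hne]
    · simp only [N.merge_eq_iff hs ht]
      have := hx.1 v hs ht
      rwa [Finset.sum_filter, Finset.sum_filter, ← Finset.sum_sub_distrib] at this
  intro v
  by_cases hs : v = N.s
  swap
  · exact hother v hs
  have htot : ∑ v, ∑ e, ((if N.merge (N.head e) = v then x e else 0)
      - (if N.merge (N.tail e) = v then x e else 0)) = 0 := by
    rw [Finset.sum_comm]
    simp
  rw [← Finset.add_sum_erase _ _ (Finset.mem_univ v), Finset.sum_eq_zero (s := Finset.univ.erase v),
    add_zero] at htot
  · exact htot
  · intro u hu
    exact hother u (fun h => (Finset.ne_of_mem_erase hu) (h.trans hs.symm))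

theorem IsFlow.add_cycle {N : Network} {x y : Fin N.m → ℝ} (hx : N.IsFlow x) (hy : N.IsFlow y)
    {χ : Fin N.m → ℤ}
    (hχ : IsCirculation (fun e => N.merge (N.tail e)) (fun e => N.merge (N.head e)) χ)
    (hχz : ∀ e, χ e ≠ 0 → |χ e| = 1 ∧ 0 < (χ e : ℝ) * (y e - x e)) {ε : ℝ} (hε : 0 ≤ ε)
    (hmin : ∀ e, χ e ≠ 0 → ε ≤ χ e * (y e - x e)) : N.IsFlow (fun e => x e + ε * χ e) := by
  refine ⟨fun v hs ht => ?_, fun e => ?_⟩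
  · have h1 := hx.1 v hs ht
    have h2 := congrArg (fun a : ℤ => (a : ℝ)) (hχ v)
    simp only [N.merge_eq_iff hs ht] at h2
    push_cast at h2
    rw [Finset.sum_sub_distrib, ← Finset.sum_filter, ← Finset.sum_filter] at h2
    rw [Finset.sum_add_distrib, Finset.sum_add_distrib, ← Finset.mul_sum, ← Finset.mul_sum]
    linear_combination h1 + ε * h2
  · have hxe := hx.2 e
    have hye := hy.2 e
    change 0 ≤ x e + ε * χ e ∧ x e + ε * χ e ≤ N.cap e
    by_cases h0 : χ e = 0
    · simpa [h0] using hxe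
    · have h3 := hmin e h0
      rcases (abs_eq (by norm_num : (0 : ℤ) ≤ 1)).1 (hχz e h0).1 with h4 | h4 <;>
        rw [h4] at h3 ⊢ <;> push_cast at * <;> constructor <;> linarith

theorem isFlow_zero (N : Network) : N.IsFlow (fun _ => 0) :=
  ⟨fun v _ _ => by simp, fun e => ⟨le_rfl, Nat.cast_nonneg _⟩⟩

end Network

namespace BudgetNetwork

variable (N : BudgetNetwork)

/-- The total usage fee `b(x)`. -/
def totalFee (x : Fin N.m → ℝ) : ℝ := ∑ e, (N.fee e : ℝ) * x e

/-- Flows that minimize the Lagrangian `c(x) + lam * b(x)` for the multiplier `lam`. -/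
def IsLagrangeOptimal (lam : ℝ) (x : Fin N.m → ℝ) : Prop :=
  N.IsFlow x ∧ ∀ y, N.IsFlow y →
    N.flowCost x + lam * N.totalFee x ≤ N.flowCost y + lam * N.totalFee y

variable {N}

theorem flowCost_add_totalFee (lam : ℝ) (x : Fin N.m → ℝ) :
    N.flowCost x + lam * N.totalFee x = ∑ e, ((N.cost e : ℝ) + lam * (N.fee e : ℝ)) * x e := by
  unfold Network.flowCost totalFee
  rw [Finset.mul_sum, ← Finset.sum_add_distrib]
  exact Finset.sum_congr rfl (fun e _ => by ring)

theorem totalFee_combination (a b : ℝ) (x y : Fin N.m → ℝ) :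
    N.totalFee (fun e => a * x e + b * y e) = a * N.totalFee x + b * N.totalFee y := by
  unfold totalFee
  rw [Finset.mul_sum, Finset.mul_sum, ← Finset.sum_add_distrib]
  exact Finset.sum_congr rfl (fun e _ => by ring)

theorem abs_sum_mul_le {m : ℕ} {a χ : Fin m → ℤ} {C K : ℤ} (hC : 0 ≤ C) (ha : ∀ e, |a e| ≤ C)
    (hχ : ∑ e, |χ e| ≤ K) : |∑ e, a e * χ e| ≤ K * C :=
  calc |∑ e, a e * χ e| ≤ ∑ e, |a e * χ e| := Finset.abs_sum_le_sum_abs _ _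
    _ ≤ ∑ e, C * |χ e| := Finset.sum_le_sum (fun e _ => by
        rw [abs_mul]
        exact mul_le_mul_of_nonneg_right (ha e) (abs_nonneg _))
    _ = C * ∑ e, |χ e| := (Finset.mul_sum _ _ _).symm
    _ ≤ C * K := mul_le_mul_of_nonneg_left hχ hC
    _ = K * C := mul_comm _ _

/-- If a flow stops being optimal when the multiplier changes, then some residual cycle becomes
negative. Its cost `p` and its fee `q` are small, because it has at most one arc per node. -/
theorem IsLagrangeOptimal.exists_cycle {C : ℕ} (hcost : ∀ e, |N.cost e| ≤ (C : ℤ))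
    (hfee : ∀ e, N.fee e ≤ C) {l₁ l₂ : ℝ} {x : Fin N.m → ℝ} (h₁ : N.IsLagrangeOptimal l₁ x)
    (h₂ : ¬ N.IsLagrangeOptimal l₂ x) :
    ∃ p q : ℤ, |p| ≤ ((N.n * C : ℕ) : ℤ) ∧ |q| ≤ ((N.n * C : ℕ) : ℤ) ∧
      0 ≤ (p : ℝ) + l₁ * q ∧ (p : ℝ) + l₂ * q < 0 := by
  by_contra hcon
  push Not at hcon
  refine h₂ ⟨h₁.1, fun y hy => ?_⟩
  have hcirc : IsCirculation (fun e => N.merge (N.tail e)) (fun e => N.merge (N.head e))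
      (fun e => y e - x e) := by
    intro v
    have a := hy.isCirculation v
    have b := h₁.1.isCirculation v
    refine Eq.trans ?_ (sub_eq_zero_of_eq (a.trans b.symm))
    rw [← Finset.sum_sub_distrib]
    refine Finset.sum_congr rfl (fun e _ => ?_)
    split_ifs <;> ring
  have key := hcirc.sum_nonneg_of_conformal
    (fun e => (N.cost e : ℝ) + l₂ * (N.fee e : ℝ)) (fun χ hχ hne hs hconf => by
    have hcast : ∀ l : ℝ, ∑ e, ((N.cost e : ℝ) + l * (N.fee e : ℝ)) * (χ e : ℝ)
        = ((∑ e, N.cost e * χ e : ℤ) : ℝ) + l * ((∑ e, (N.fee e : ℤ) * χ e : ℤ) : ℝ) := by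
      intro l
      push_cast
      rw [Finset.mul_sum, ← Finset.sum_add_distrib]
      exact Finset.sum_congr rfl (fun e _ => by ring)
    rw [hcast]
    rw [Fintype.card_fin] at hs
    refine hcon _ _ ?_ ?_ ?_
    · push_cast
      exact abs_sum_mul_le (Nat.cast_nonneg _) hcost hs
    · push_cast
      exact abs_sum_mul_le (Nat.cast_nonneg _) (fun e => by simpa using hfee e) hs
    · rw [← hcast]
      obtain ⟨ε, hε, hmin, -⟩ := exists_pos_le_conformal hne hconf
      have := h₁.2 _ (h₁.1.add_cycle hy hχ hconf hε.le hmin)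
      rw [flowCost_add_totalFee, flowCost_add_totalFee] at this
      have h5 : ∑ e, ((N.cost e : ℝ) + l₁ * (N.fee e : ℝ)) * (x e + ε * (χ e : ℝ))
          = ∑ e, ((N.cost e : ℝ) + l₁ * (N.fee e : ℝ)) * x e
            + ε * ∑ e, ((N.cost e : ℝ) + l₁ * (N.fee e : ℝ)) * (χ e : ℝ) := by
        rw [Finset.mul_sum, ← Finset.sum_add_distrib]
        exact Finset.sum_congr rfl (fun e _ => by ring)
      rw [h5] at this
      exact nonneg_of_mul_nonneg_right (by linarith) hε)
  rw [flowCost_add_totalFee, flowCost_add_totalFee]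
  simp only [mul_sub, Finset.sum_sub_distrib] at key
  linarith

end BudgetNetwork

/-- The fractions `p / q` with `|p| ≤ K` and `1 ≤ q ≤ K`. For `K = n * C` they include all
multipliers at which the set of optimum solutions of the Lagrangian relaxation changes. -/
def IsBreakpoint (K : ℕ) (μ : ℝ) : Prop :=
  ∃ p q : ℤ, |p| ≤ (K : ℤ) ∧ 0 < q ∧ q ≤ (K : ℤ) ∧ (q : ℝ) * μ = p

theorem IsBreakpoint.le {K : ℕ} {μ : ℝ} (h : IsBreakpoint K μ) : μ ≤ K := by
  obtain ⟨p, q, hp, hq, -, h⟩ := h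
  by_contra hcon
  push Not at hcon
  have h1 : (1 : ℝ) ≤ q := by exact_mod_cast hq
  have h2 : (p : ℝ) ≤ K := by exact_mod_cast (le_abs_self p).trans hp
  have h3 : (0 : ℝ) ≤ K := Nat.cast_nonneg _
  nlinarith

theorem IsBreakpoint.eq_of_close {K : ℕ} {μ ν : ℝ} (h : IsBreakpoint K μ) (h' : IsBreakpoint K ν)
    (hclose : |μ - ν| * (K : ℝ) ^ 2 < 1) : μ = ν := by
  obtain ⟨p, q, -, hq, hqK, h⟩ := h
  obtain ⟨p', q', -, hq', hqK', h'⟩ := h'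
  have hqr : (0 : ℝ) < q := by exact_mod_cast hq
  have hqr' : (0 : ℝ) < q' := by exact_mod_cast hq'
  have hqK2 : (q : ℝ) ≤ K := by exact_mod_cast hqK
  have hqK2' : (q' : ℝ) ≤ K := by exact_mod_cast hqK'
  have h1 : ((p * q' - p' * q : ℤ) : ℝ) = q * q' * (μ - ν) := by
    push_cast
    rw [← h, ← h']
    ring
  have h2 : |((p * q' - p' * q : ℤ) : ℝ)| < 1 := by
    rw [h1, abs_mul, abs_of_pos (mul_pos hqr hqr')]
    refine lt_of_le_of_lt ?_ hclose
    rw [mul_comm, sq]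
    exact mul_le_mul_of_nonneg_left (mul_le_mul hqK2 hqK2' hqr'.le (by positivity)) (abs_nonneg _)
  have h3 : p * q' - p' * q = 0 := by
    rw [← Int.abs_lt_one_iff]
    exact_mod_cast h2
  rw [h3] at h1
  push_cast at h1
  have := (mul_eq_zero.1 h1.symm).resolve_left (mul_pos hqr hqr').ne'
  linarith

namespace BudgetNetwork

variable {N : BudgetNetwork}

theorem IsLagrangeOptimal.exists_breakpoint {C : ℕ} (hcost : ∀ e, |N.cost e| ≤ (C : ℤ))
    (hfee : ∀ e, N.fee e ≤ C) {l₁ l₂ : ℝ} {x : Fin N.m → ℝ} (h₁ : N.IsLagrangeOptimal l₁ x)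
    (h₂ : ¬ N.IsLagrangeOptimal l₂ x) :
    ∃ μ, IsBreakpoint (N.n * C) μ ∧ (l₁ ≤ μ ∧ μ < l₂ ∨ l₂ < μ ∧ μ ≤ l₁) := by
  obtain ⟨p, q, hp, hq, hn, hneg⟩ := h₁.exists_cycle hcost hfee h₂
  rcases lt_trichotomy q 0 with h | h | h
  · have hr : (q : ℝ) < 0 := by exact_mod_cast h
    refine ⟨-p / q, ⟨p, -q, hp, by omega, (neg_le_abs q).trans hq, ?_⟩, Or.inl ⟨?_, ?_⟩⟩
    · push_cast
      field_simp [hr.ne]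
    · rw [le_div_iff_of_neg hr]
      linarith
    · rw [div_lt_iff_of_neg hr]
      linarith
  · subst h
    push_cast at hn hneg
    linarith
  · have hr : (0 : ℝ) < q := by exact_mod_cast h
    refine ⟨-p / q, ⟨-p, q, by rwa [abs_neg], h, (le_abs_self q).trans hq, ?_⟩, Or.inr ⟨?_, ?_⟩⟩
    · push_cast
      field_simp
    · rw [lt_div_iff₀ hr]
      linarith
    · rw [div_le_iff₀ hr]
      linarith

/-- Flows that are optimal for two close multipliers are both optimal for a common multiplier,
because at most one breakpoint lies between the two. -/
theorem IsLagrangeOptimal.exists_common {C : ℕ} (hcost : ∀ e, |N.cost e| ≤ (C : ℤ))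
    (hfee : ∀ e, N.fee e ≤ C) {l₁ l₂ : ℝ} (hl : l₁ ≤ l₂)
    (hclose : (l₂ - l₁) * ((N.n * C : ℕ) : ℝ) ^ 2 < 1) {x y : Fin N.m → ℝ}
    (hx : N.IsLagrangeOptimal l₁ x) (hy : N.IsLagrangeOptimal l₂ y) :
    ∃ l, l₁ ≤ l ∧ N.IsLagrangeOptimal l x ∧ N.IsLagrangeOptimal l y := by
  have huniq : ∀ μ ν, IsBreakpoint (N.n * C) μ → IsBreakpoint (N.n * C) ν → l₁ ≤ μ → μ ≤ l₂ →
      l₁ ≤ ν → ν ≤ l₂ → μ = ν := by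
    intro μ ν hμ hν a b c d
    refine hμ.eq_of_close hν (lt_of_le_of_lt ?_ hclose)
    exact mul_le_mul_of_nonneg_right (abs_le.2 ⟨by linarith, by linarith⟩) (sq_nonneg _)
  by_cases hex : ∃ μ, IsBreakpoint (N.n * C) μ ∧ l₁ ≤ μ ∧ μ ≤ l₂
  · obtain ⟨μ, hμ, h1, h2⟩ := hex
    refine ⟨μ, h1, ?_, ?_⟩
    · by_contra hcon
      obtain ⟨ν, hν, h | h⟩ := hx.exists_breakpoint hcost hfee hcon
      · exact h.2.ne (huniq ν μ hν hμ h.1 (by linarith) h1 h2)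
      · linarith
    · by_contra hcon
      obtain ⟨ν, hν, h | h⟩ := hy.exists_breakpoint hcost hfee hcon
      · linarith
      · exact h.1.ne' (huniq ν μ hν hμ (by linarith) h.2 h1 h2)
  · refine ⟨l₁, le_rfl, hx, ?_⟩
    by_contra hcon
    obtain ⟨ν, hν, h | h⟩ := hy.exists_breakpoint hcost hfee hcon
    · linarith
    · exact hex ⟨ν, hν, h.1.le, h.2⟩

/-- Above all breakpoints, an optimum solution of the Lagrangian relaxation minimizes the fee, and
the zero flow has fee zero. -/
theorem IsLagrangeOptimal.totalFee_nonpos {C : ℕ} (hcost : ∀ e, |N.cost e| ≤ (C : ℤ))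
    (hfee : ∀ e, N.fee e ≤ C) {l : ℝ} (hl : ((N.n * C : ℕ) : ℝ) < l) {x : Fin N.m → ℝ}
    (hx : N.IsLagrangeOptimal l x) : N.totalFee x ≤ 0 := by
  by_contra hcon
  push Not at hcon
  have hall : ∀ l', l ≤ l' → N.IsLagrangeOptimal l' x := by
    intro l' hl'
    by_contra h
    obtain ⟨μ, hμ, h | h⟩ := hx.exists_breakpoint hcost hfee h
    · linarith [hμ.le]
    · linarith
  have h1 := (hall (l + (|N.flowCost x| + 1) / N.totalFee x)
    (le_add_of_nonneg_right (by positivity))).2 _ N.isFlow_zero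
  have h2 : N.flowCost (fun _ => 0) = 0 := by simp [Network.flowCost]
  have h3 : N.totalFee (fun _ => 0) = 0 := by simp [totalFee]
  rw [h2, h3, add_mul, div_mul_cancel₀ _ hcon.ne'] at h1
  have h4 : 0 ≤ l := le_trans (Nat.cast_nonneg _) hl.le
  have h5 := neg_abs_le (N.flowCost x)
  have h6 : 0 ≤ l * N.totalFee x := by positivity
  linarith

theorem IsLagrangeOptimal.isOptimal {x : Fin N.m → ℝ} {l : ℝ} (hl : 0 ≤ l)
    (hx : N.IsLagrangeOptimal l x) (hfee : N.totalFee x ≤ N.budget)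
    (hslack : l * (N.totalFee x - N.budget) = 0) : N.IsOptimal x := by
  refine ⟨⟨hx.1, hfee⟩, fun y hy => ?_⟩
  have h1 := hx.2 y hy.1
  have h2 : N.totalFee y ≤ N.budget := hy.2
  have h3 := mul_le_mul_of_nonneg_left h2 hl
  linarith

theorem IsLagrangeOptimal.convex {x y : Fin N.m → ℝ} {l a b : ℝ} (ha : 0 ≤ a) (hb : 0 ≤ b)
    (hab : a + b = 1) (hx : N.IsLagrangeOptimal l x) (hy : N.IsLagrangeOptimal l y) :
    N.IsLagrangeOptimal l (fun e => a * x e + b * y e) := by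
  refine ⟨⟨fun v hs ht => ?_, fun e => ?_⟩, fun z hz => ?_⟩
  · have h1 := hx.1.1 v hs ht
    have h2 := hy.1.1 v hs ht
    simp only [Finset.sum_add_distrib, ← Finset.mul_sum]
    linear_combination a * h1 + b * h2
  · have h1 := hx.1.2 e
    have h2 := hy.1.2 e
    refine ⟨add_nonneg (mul_nonneg ha h1.1) (mul_nonneg hb h2.1), ?_⟩
    have h3 := mul_le_mul_of_nonneg_left h1.2 ha
    have h4 := mul_le_mul_of_nonneg_left h2.2 hb
    calc _ ≤ a * (N.cap e : ℝ) + b * (N.cap e : ℝ) := add_le_add h3 h4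
      _ = _ := by rw [← add_mul, hab, one_mul]
  · have h1 := mul_le_mul_of_nonneg_left (hx.2 z hz) ha
    have h2 := mul_le_mul_of_nonneg_left (hy.2 z hz) hb
    have h3 : N.flowCost (fun e => a * x e + b * y e) + l * N.totalFee (fun e => a * x e + b * y e)
      = a * (N.flowCost x + l * N.totalFee x) + b * (N.flowCost y + l * N.totalFee y) := by
      simp only [flowCost_add_totalFee, Finset.mul_sum, ← Finset.sum_add_distrib]
      exact Finset.sum_congr rfl (fun e _ => by ring)
    rw [h3]
    calc _ ≤ _ := add_le_add h1 h2
      _ = _ := by rw [← add_mul, hab, one_mul]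

/-- The optimum solution is the convex combination, with total fee exactly the budget, of two
optimum solutions of the Lagrangian relaxation for close multipliers, one above and one within the
budget. -/
theorem isOptimal_combination {C : ℕ} (hcost : ∀ e, |N.cost e| ≤ (C : ℤ))
    (hfee : ∀ e, N.fee e ≤ C) {l₁ l₂ : ℝ} (h0 : 0 ≤ l₁) (hl : l₁ ≤ l₂)
    (hclose : (l₂ - l₁) * ((N.n * C : ℕ) : ℝ) ^ 2 < 1) {x y : Fin N.m → ℝ}
    (hx : N.IsLagrangeOptimal l₁ x) (hy : N.IsLagrangeOptimal l₂ y)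
    (hxB : (N.budget : ℝ) < N.totalFee x) (hyB : N.totalFee y ≤ N.budget) :
    N.IsOptimal (fun e => ((N.budget - N.totalFee y) * x e + (N.totalFee x - N.budget) * y e) /
      (N.totalFee x - N.totalFee y)) := by
  obtain ⟨l, hl', hx', hy'⟩ := hx.exists_common hcost hfee hl hclose hy
  have hpos : 0 < N.totalFee x - N.totalFee y := by linarith
  have hz := hx'.convex (a := (N.budget - N.totalFee y) / (N.totalFee x - N.totalFee y))
    (b := (N.totalFee x - N.budget) / (N.totalFee x - N.totalFee y))
    (div_nonneg (by linarith) hpos.le) (div_nonneg (by linarith) hpos.le)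
    (by rw [← add_div, div_eq_one_iff_eq hpos.ne']; ring) hy'
  have heq : (fun e => (N.budget - N.totalFee y) / (N.totalFee x - N.totalFee y) * x e
      + (N.totalFee x - N.budget) / (N.totalFee x - N.totalFee y) * y e)
      = (fun e => ((N.budget - N.totalFee y) * x e + (N.totalFee x - N.budget) * y e) /
      (N.totalFee x - N.totalFee y)) := by
    funext e
    ring
  have hB : N.totalFee (fun e => (N.budget - N.totalFee y) / (N.totalFee x - N.totalFee y) * x e
      + (N.totalFee x - N.budget) / (N.totalFee x - N.totalFee y) * y e) = N.budget := by
    rw [totalFee_combination]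
    field_simp
    ring
  rw [← heq]
  exact hz.isOptimal (h0.trans hl') hB.le (by rw [hB]; ring)

variable (N) in
/-- The network with the integral costs `D * c + k * b`, for the multiplier `k / D`. -/
def scaled (D k : ℤ) : Network :=
  { N.toNetwork with cost := fun e => D * N.cost e + k * (N.fee e : ℤ) }

theorem isLagrangeOptimal_of_scaled {D k : ℤ} (hD : 0 < D) {x : Fin N.m → ℝ}
    (hx : (N.scaled D k).IsMinCostFlow x) : N.IsLagrangeOptimal ((k : ℝ) / D) x := by
  have hDr : (0 : ℝ) < D := by exact_mod_cast hD
  have hcost : ∀ y : Fin N.m → ℝ, (N.scaled D k).flowCost y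
      = D * (N.flowCost y + (k : ℝ) / D * N.totalFee y) := by
    intro y
    have : (N.scaled D k).flowCost y
      = ∑ e, ((D * N.cost e + k * (N.fee e : ℤ) : ℤ) : ℝ) * y e := rfl
    rw [this, flowCost_add_totalFee, Finset.mul_sum]
    refine Finset.sum_congr rfl (fun e _ => ?_)
    push_cast
    field_simp
  refine ⟨hx.1, fun y hy => ?_⟩
  have := hx.2 y hy
  rw [hcost, hcost] at this
  exact le_of_mul_le_mul_left this hDr

end BudgetNetwork

/-! ### Frame properties of the machine -/

@[simp] theorem State.reg_setReg (σ : State) (x y : ℕ) (v : ℤ) :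
    (σ.setReg x v).reg y = if y = x then v else σ.reg y := by
  simp [State.setReg, Function.update_apply]

@[simp] theorem State.arr_setReg (σ : State) (x : ℕ) (v : ℤ) : (σ.setReg x v).arr = σ.arr := rfl

@[simp] theorem State.reg_setArr (σ : State) (a : ℕ) (i v : ℤ) : (σ.setArr a i v).reg = σ.reg :=
  rfl

@[simp] theorem State.arr_setArr (σ : State) (a b : ℕ) (i v : ℤ) :
    (σ.setArr a i v).arr b = if b = a then Function.update (σ.arr a) i v else σ.arr b := by
  by_cases h : b = a
  · subst h
    simp [State.setArr]
  · simp [State.setArr, h]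

theorem Exec.mono {W W' : ℕ} (hW : W ≤ W') {P : Program} {σ σ' : State} {τ : ℕ}
    (h : Exec W P σ σ' τ) : Exec W' P σ σ' τ := by
  have hW' : (W : ℤ) ≤ W' := by exact_mod_cast hW
  induction h with
  | nop σ => exact .nop σ
  | const σ x a h => exact .const σ x a (h.trans hW')
  | arith σ o x y z h => exact .arith σ o x y z (h.trans hW')
  | load σ x a i h => exact .load σ x a i (h.trans hW')
  | store σ a i x h => exact .store σ a i x (h.trans hW')
  | seq _ _ ih ih' => exact .seq ih ih'
  | condPos hx _ ih => exact .condPos hx ih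
  | condNonpos hx _ ih => exact .condNonpos hx ih
  | loopPos hx _ _ ih ih' => exact .loopPos hx ih ih'
  | loopNonpos hx => exact .loopNonpos hx

/-- A strict upper bound on the indices of the registers and arrays that a program writes to. -/
def Program.writeBound : Program → ℕ
  | .nop => 0
  | .const x _ => x + 1
  | .arith _ x _ _ => x + 1
  | .load x _ _ => x + 1
  | .store a _ _ => a + 1
  | .seq P Q => max P.writeBound Q.writeBound
  | .cond _ P Q => max P.writeBound Q.writeBound
  | .loop _ P => P.writeBound

theorem Exec.frame {W : ℕ} {P : Program} {σ σ' : State} {τ : ℕ} (h : Exec W P σ σ' τ) :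
    (∀ r, P.writeBound ≤ r → σ'.reg r = σ.reg r) ∧
      ∀ a, P.writeBound ≤ a → σ'.arr a = σ.arr a := by
  induction h with
  | nop | loopNonpos => simp
  | const σ x a h | arith σ o x y z h | load σ x a i h =>
    refine ⟨fun r hr => ?_, fun _ _ => rfl⟩
    simp only [Program.writeBound] at hr
    simp [show r ≠ x by omega]
  | store σ a i x h =>
    refine ⟨fun _ _ => rfl, fun b hb => ?_⟩
    simp only [Program.writeBound] at hb
    simp [show b ≠ a by omega]
  | seq _ _ ih ih' =>
    simp only [Program.writeBound, max_le_iff]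
    exact ⟨fun r hr => (ih'.1 r hr.2).trans (ih.1 r hr.1),
      fun r hr => (ih'.2 r hr.2).trans (ih.2 r hr.1)⟩
  | condPos _ _ ih =>
    simp only [Program.writeBound, max_le_iff]
    exact ⟨fun r hr => ih.1 r hr.1, fun r hr => ih.2 r hr.1⟩
  | condNonpos _ _ ih =>
    simp only [Program.writeBound, max_le_iff]
    exact ⟨fun r hr => ih.1 r hr.2, fun r hr => ih.2 r hr.2⟩
  | loopPos _ _ _ ih ih' =>
    exact ⟨fun r hr => (ih'.1 r hr).trans (ih.1 r hr), fun r hr => (ih'.2 r hr).trans (ih.2 r hr)⟩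

/-- The content of a memory cell: a register, or an entry of an array. -/
def State.cell (σ : State) : ℕ ⊕ ℕ × ℤ → ℤ
  | .inl r => σ.reg r
  | .inr (a, i) => σ.arr a i

/-- A run of `τ` steps changes at most `τ` memory cells. -/
theorem Exec.exists_changed {W : ℕ} {P : Program} {σ σ' : State} {τ : ℕ} (h : Exec W P σ σ' τ) :
    ∃ S : Finset (ℕ ⊕ ℕ × ℤ), S.card ≤ τ ∧ ∀ c, c ∉ S → σ'.cell c = σ.cell c := by
  classical
  induction h with
  | nop | loopNonpos => exact ⟨∅, by simp, fun _ _ => rfl⟩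
  | const σ x a h | arith σ o x y z h | load σ x a i h =>
    refine ⟨{.inl x}, by simp, ?_⟩
    rintro (r | ⟨a, i⟩) hc
    · simp only [Finset.mem_singleton, Sum.inl.injEq] at hc
      simp [State.cell, hc]
    · rfl
  | store σ a i x h =>
    refine ⟨{.inr (a, σ.reg i)}, by simp, ?_⟩
    rintro (r | ⟨b, j⟩) hc
    · rfl
    · simp only [Finset.mem_singleton, Sum.inr.injEq, Prod.mk.injEq, not_and] at hc
      by_cases hb : b = a
      · subst hb
        simp [State.cell, hc rfl]
      · simp [State.cell, hb]
  | seq _ _ ih ih' =>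
    obtain ⟨S, hS, h⟩ := ih
    obtain ⟨S', hS', h'⟩ := ih'
    refine ⟨S ∪ S', (Finset.card_union_le _ _).trans (by omega), fun c hc => ?_⟩
    rw [Finset.mem_union, not_or] at hc
    exact (h' c hc.2).trans (h c hc.1)
  | condPos _ _ ih | condNonpos _ _ ih =>
    obtain ⟨S, hS, h⟩ := ih
    exact ⟨S, by omega, h⟩
  | loopPos _ _ _ ih ih' =>
    obtain ⟨S, hS, h⟩ := ih
    obtain ⟨S', hS', h'⟩ := ih'
    refine ⟨S ∪ S', (Finset.card_union_le _ _).trans (by omega), fun c hc => ?_⟩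
    rw [Finset.mem_union, not_or] at hc
    exact (h' c hc.2).trans (h c hc.1)

theorem Exec.reg_eq_or_abs_le {W : ℕ} {P : Program} {σ σ' : State} {τ : ℕ}
    (h : Exec W P σ σ' τ) (r : ℕ) : σ'.reg r = σ.reg r ∨ |σ'.reg r| ≤ (W : ℤ) := by
  induction h with
  | nop | loopNonpos | store => exact Or.inl rfl
  | const σ x a h | arith σ o x y z h | load σ x a i h =>
    by_cases hr : r = x
    · right
      simpa [hr] using h
    · left
      simp [hr]
  | seq _ _ ih ih' | loopPos _ _ _ ih ih' =>
    rcases ih' with h' | h'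
    · rw [h']
      exact ih
    · exact Or.inr h'
  | condPos _ _ ih | condNonpos _ _ ih => exact ih

/-- Solving the minimum cost flow problem on `m` edges takes more than `m` steps: on a memory that
initially holds values out of range in place of the output, every numerator and the denominator have
to be overwritten. -/
theorem SolvesMCF.lt_time {A : Program} {w : ℕ} {T : ℕ → ℕ → ℕ → ℕ → ℕ} (hA : SolvesMCF A w T)
    {m n C U : ℕ} (hn : 1 ≤ n) (hC : 1 ≤ C) (hU : 1 ≤ U) : m + 1 ≤ T m n C U := by
  classical
  -- all capacities are zero, so the numerators `1` that the memory holds initially are wrong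
  let N : Network := ⟨n, m, fun _ => ⟨0, hn⟩, fun _ => ⟨0, hn⟩, fun _ => 0, fun _ => 0,
    ⟨0, hn⟩, ⟨0, hn⟩⟩
  let σ : State := ⟨fun r => if r = 0 then n else if r = 1 then m else 0,
    fun a _ => if a = 5 then 1 else 0⟩
  have hσ : N.StoredIn σ := by
    simp [Network.StoredIn, N, σ]
  obtain ⟨σ', τ, x, hex, hτ, ⟨hpos, hout⟩, hx⟩ :=
    hA N C U hC hU (by simp [N]) (by simp [N]) σ hσ
  refine le_trans ?_ hτ
  obtain ⟨S, hS, hunch⟩ := hex.exists_changed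
  refine le_trans ?_ hS
  have hsub : insert (.inl 5) ((Finset.univ : Finset (Fin m)).image
      (fun e : Fin m => (.inr (5, ((e : ℕ) : ℤ)) : ℕ ⊕ ℕ × ℤ))) ⊆ S := by
    intro c hc
    by_contra hcS
    have h1 := hunch c hcS
    rw [Finset.mem_insert, Finset.mem_image] at hc
    rcases hc with rfl | ⟨e, -, rfl⟩
    · have h2 : σ'.reg 5 = 0 := by simpa [State.cell, σ] using h1
      omega
    · have h2 : σ'.arr 5 ((e : ℕ) : ℤ) = 1 := by simpa [State.cell, σ] using h1
      have h3 := hout e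
      rw [h2] at h3
      have h4 := (hx.1.2 e).2
      have h5 : (0 : ℝ) < σ'.reg 5 := by exact_mod_cast hpos
      have h6 : 0 < x e := by
        rw [h3]
        positivity
      have h7 : ((N.cap e : ℕ) : ℝ) = 0 := by simp [N]
      linarith
  refine le_trans ?_ (Finset.card_le_card hsub)
  rw [Finset.card_insert_of_notMem (by simp), Finset.card_image_of_injective, Finset.card_univ,
    Fintype.card_fin]
  intro a b hab
  simpa [Fin.ext_iff] using hab

/-! ### A program logic for time-bounded total correctness -/

/-- Started in `σ`, the program `P` halts after at most `t` steps in a state with property `Q`, and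
all numbers fit into words of size `W`. -/
def Runs (W : ℕ) (P : Program) (σ : State) (t : ℕ) (Q : State → Prop) : Prop :=
  ∃ σ' τ, Exec W P σ σ' τ ∧ τ ≤ t ∧ Q σ'

theorem Runs.mono {W : ℕ} {P : Program} {σ : State} {t t' : ℕ} {Q Q' : State → Prop}
    (h : Runs W P σ t Q) (ht : t ≤ t') (hQ : ∀ σ', Q σ' → Q' σ') : Runs W P σ t' Q' := by
  obtain ⟨σ', τ, he, hτ, hq⟩ := h
  exact ⟨σ', τ, he, hτ.trans ht, hQ _ hq⟩

theorem Runs.seq {W : ℕ} {P P' : Program} {σ : State} {t t' : ℕ} {Q R : State → Prop}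
    (h : Runs W P σ t Q) (h' : ∀ σ', Q σ' → Runs W P' σ' t' R) :
    Runs W (.seq P P') σ (t + t') R := by
  obtain ⟨σ', τ, he, hτ, hq⟩ := h
  obtain ⟨σ'', τ', he', hτ', hq'⟩ := h' _ hq
  exact ⟨σ'', τ + τ', he.seq he', by omega, hq'⟩

/-- A finite sequence of programs, run one after the other. -/
def block : List Program → Program
  | [] => .nop
  | P :: l => .seq P (block l)

/-- Weakest preconditions of programs without loops; a loop gets the precondition `False`. -/
def wp (W : ℕ) : Program → State → (State → Prop) → Prop
  | .nop, σ, Q => Q σ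
  | .const x a, σ, Q => |a| ≤ (W : ℤ) ∧ Q (σ.setReg x a)
  | .arith o x y z, σ, Q => |o.eval (σ.reg y) (σ.reg z)| ≤ (W : ℤ) ∧
      Q (σ.setReg x (o.eval (σ.reg y) (σ.reg z)))
  | .load x a i, σ, Q => |σ.arr a (σ.reg i)| ≤ (W : ℤ) ∧ Q (σ.setReg x (σ.arr a (σ.reg i)))
  | .store a i x, σ, Q => |σ.reg x| ≤ (W : ℤ) ∧ Q (σ.setArr a (σ.reg i) (σ.reg x))
  | .seq P P', σ, Q => wp W P σ (fun σ' => wp W P' σ' Q)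
  | .cond x P P', σ, Q => (0 < σ.reg x → wp W P σ Q) ∧ (σ.reg x ≤ 0 → wp W P' σ Q)
  | .loop _ _, _, _ => False

/-- The maximum number of steps of a program without loops; the value for loops is irrelevant. -/
def steps : Program → ℕ
  | .nop => 0
  | .const _ _ => 1
  | .arith _ _ _ _ => 1
  | .load _ _ _ => 1
  | .store _ _ _ => 1
  | .seq P P' => steps P + steps P'
  | .cond _ P P' => max (steps P) (steps P') + 1
  | .loop _ _ => 0

theorem runs_of_wp {W : ℕ} {P : Program} {σ : State} {Q : State → Prop} (h : wp W P σ Q) :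
    Runs W P σ (steps P) Q := by
  induction P generalizing σ Q with
  | nop => exact ⟨σ, 0, .nop σ, le_rfl, h⟩
  | const x a => exact ⟨_, _, .const σ x a h.1, le_rfl, h.2⟩
  | arith o x y z => exact ⟨_, _, .arith σ o x y z h.1, le_rfl, h.2⟩
  | load x a i => exact ⟨_, _, .load σ x a i h.1, le_rfl, h.2⟩
  | store a i x => exact ⟨_, _, .store σ a i x h.1, le_rfl, h.2⟩
  | seq P P' ih ih' => exact (ih h).seq (fun σ' hσ' => ih' hσ')
  | cond x P P' ih ih' =>
    rcases lt_or_ge 0 (σ.reg x) with hx | hx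
    · obtain ⟨σ', τ, he, hτ, hq⟩ := ih (h.1 hx)
      exact ⟨σ', τ + 1, .condPos hx he, by simp only [steps]; omega, hq⟩
    · obtain ⟨σ', τ, he, hτ, hq⟩ := ih' (h.2 hx)
      exact ⟨σ', τ + 1, .condNonpos hx he, by simp only [steps]; omega, hq⟩
  | loop => exact h.elim

theorem runs_cond {W : ℕ} {x : ℕ} {P P' : Program} {σ : State} {t : ℕ} {Q : State → Prop}
    (h : 0 < σ.reg x → Runs W P σ t Q) (h' : σ.reg x ≤ 0 → Runs W P' σ t Q) :
    Runs W (.cond x P P') σ (t + 1) Q := by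
  rcases lt_or_ge 0 (σ.reg x) with hx | hx
  · obtain ⟨σ', τ, he, hτ, hq⟩ := h hx
    exact ⟨σ', τ + 1, .condPos hx he, by omega, hq⟩
  · obtain ⟨σ', τ, he, hτ, hq⟩ := h' hx
    exact ⟨σ', τ + 1, .condNonpos hx he, by omega, hq⟩

/-- The rule for loops: the argument of the invariant bounds the number of remaining rounds. -/
theorem runs_loop {W x t : ℕ} {P : Program} (Inv : ℕ → State → Prop)
    (hstep : ∀ h σ, Inv h σ → 0 < σ.reg x → ∃ h', h = h' + 1 ∧ Runs W P σ t (Inv h')) {h : ℕ}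
    {σ : State} (h0 : Inv h σ) :
    Runs W (.loop x P) σ ((t + 1) * h + 1) (fun σ' => σ'.reg x ≤ 0 ∧ ∃ h', Inv h' σ') := by
  induction h generalizing σ with
  | zero =>
    rcases lt_or_ge 0 (σ.reg x) with hx | hx
    · obtain ⟨h', hh, -⟩ := hstep _ _ h0 hx
      omega
    · exact ⟨σ, 1, .loopNonpos hx, by simp, hx, _, h0⟩
  | succ h ih =>
    rcases lt_or_ge 0 (σ.reg x) with hx | hx
    · obtain ⟨h', hh, σ', τ, he, hτ, hi⟩ := hstep _ _ h0 hx
      obtain rfl : h = h' := by omega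
      obtain ⟨σ'', τ', he', hτ', hi'⟩ := ih hi
      refine ⟨σ'', _, .loopPos hx he he', ?_, hi'⟩
      rw [mul_add]
      omega
    · exact ⟨σ, 1, .loopNonpos hx, by simp, hx, _, h0⟩

/-- `for reg i := 0, …, reg m - 1 do body`, where `reg g` counts the remaining rounds. -/
def forLoop (i g m : ℕ) (body : Program) : Program :=
  block [.const i 0, .arith .sub g m i,
    .loop g (block [body, .const g 1, .arith .add i i g, .arith .sub g m i])]

theorem runs_forLoop {W i g m t M : ℕ} {body : Program} (Inv : ℕ → State → Prop) {σ : State}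
    (hM : M ≤ W) (hW : 1 ≤ W) (him : i ≠ m) (hgm : g ≠ m) (hig : i ≠ g)
    (hm : ∀ j σ, Inv j σ → σ.reg m = M)
    (hI : ∀ j σ v, Inv j σ → Inv j (σ.setReg i v)) (hG : ∀ j σ v, Inv j σ → Inv j (σ.setReg g v))
    (hbody : ∀ j σ, j < M → Inv j σ → σ.reg i = j →
      Runs W body σ t (fun σ' => Inv (j + 1) σ' ∧ σ'.reg i = j))
    (h0 : Inv 0 σ) : Runs W (forLoop i g m body) σ ((t + 4) * M + 3) (Inv M) := by
  have hM' : (M : ℤ) ≤ W := by exact_mod_cast hM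
  have hW' : (1 : ℤ) ≤ W := by exact_mod_cast hW
  -- `h` rounds remain, as register `g` tells
  let Inv' : ℕ → State → Prop := fun h σ =>
    ∃ j : ℕ, j + h = M ∧ Inv j σ ∧ σ.reg i = j ∧ σ.reg g = h
  have hloop : ∀ σ, Inv' M σ → Runs W
      (.loop g (block [body, .const g 1, .arith .add i i g, .arith .sub g m i])) σ
      ((t + 3 + 1) * M + 1) (fun σ' => σ'.reg g ≤ 0 ∧ ∃ h', Inv' h' σ') := by
    intro σ hσ
    refine runs_loop Inv' ?_ hσ
    rintro h σ ⟨j, hj, hinv, hi, hg⟩ hpos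
    obtain ⟨h', rfl⟩ : ∃ h', h = h' + 1 := ⟨h - 1, by omega⟩
    refine ⟨h', rfl, (hbody j σ (by omega) hinv hi).seq ?_⟩
    rintro σ' ⟨hinv', hi'⟩
    refine (runs_of_wp ?_).mono (le_of_eq rfl) (fun _ h => h)
    have hm' := hm _ _ hinv'
    simp only [block, wp, Op.eval, State.reg_setReg, hi', hm', if_neg him.symm,
      if_neg hgm.symm, if_neg hig, if_true]
    refine ⟨by simpa using hW', ?_, ?_, j + 1, by omega, hG _ _ _ (hI _ _ _ (hG _ _ _ hinv')), ?_,
      ?_⟩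
    · rw [abs_of_nonneg (by positivity)]
      omega
    · rw [abs_le]
      omega
    · simp [hig]
    · simp
      omega
  refine Runs.mono (t := 1 + (1 + ((t + 3 + 1) * M + 1 + 0))) (Q := Inv M) ?_
    (by ring_nf; omega) (fun _ h => h)
  refine Runs.seq (Q := fun σ => Inv 0 σ ∧ σ.reg i = 0)
    (runs_of_wp (P := .const i 0) ⟨by simp, hI _ _ _ h0, by simp⟩) ?_
  rintro σ ⟨hinv, hi⟩
  refine Runs.seq (Q := Inv' M) (runs_of_wp (P := .arith .sub g m i) ⟨?_, 0, by omega,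
    hG _ _ _ hinv, ?_, ?_⟩) ?_
  · simpa [Op.eval, hi, hm _ _ hinv] using hM'
  · simp [hig, hi]
  · simp [Op.eval, hi, hm _ _ hinv]
  intro σ hσ
  refine (hloop σ hσ).seq (Q := _) ?_
  rintro σ' ⟨hg, h', j, hj, hinv', -, hg'⟩
  obtain rfl : j = M := by omega
  exact runs_of_wp (P := .nop) hinv'

/-! ### The loops over the edges -/

/-- `σ'` agrees with `σ` except for the registers in `R` and the arrays in `A`. -/
def Unchanged (R A : List ℕ) (σ σ' : State) : Prop :=
  (∀ r, r ∉ R → σ'.reg r = σ.reg r) ∧ ∀ a, a ∉ A → σ'.arr a = σ.arr a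

theorem Unchanged.refl (R A : List ℕ) (σ : State) : Unchanged R A σ σ :=
  ⟨fun _ _ => rfl, fun _ _ => rfl⟩

theorem Unchanged.trans {R A : List ℕ} {σ σ' σ'' : State} (h : Unchanged R A σ σ')
    (h' : Unchanged R A σ' σ'') : Unchanged R A σ σ'' :=
  ⟨fun r hr => (h'.1 r hr).trans (h.1 r hr), fun a ha => (h'.2 a ha).trans (h.2 a ha)⟩

theorem Unchanged.mono {R A R' A' : List ℕ} {σ σ' : State} (h : Unchanged R A σ σ') (hR : R ⊆ R')
    (hA : A ⊆ A') : Unchanged R' A' σ σ' :=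
  ⟨fun r hr => h.1 r (fun h => hr (hR h)), fun a ha => h.2 a (fun h => ha (hA h))⟩

theorem Unchanged.setReg {R A : List ℕ} {σ σ' : State} (h : Unchanged R A σ σ') {x : ℕ}
    (hx : x ∈ R) (v : ℤ) : Unchanged R A σ (σ'.setReg x v) := by
  refine ⟨fun r hr => ?_, h.2⟩
  rw [State.reg_setReg, if_neg (by rintro rfl; exact hr hx)]
  exact h.1 r hr

theorem Unchanged.setArr {R A : List ℕ} {σ σ' : State} (h : Unchanged R A σ σ') {a : ℕ}
    (ha : a ∈ A) (i v : ℤ) : Unchanged R A σ (σ'.setArr a i v) := by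
  refine ⟨h.1, fun b hb => ?_⟩
  rw [State.arr_setArr, if_neg (by rintro rfl; exact hb ha)]
  exact h.2 b hb

/-- `for every edge do body`. The number of edges is held by register `k + 7`, and the index of the
edge by register `k + 18`. -/
def forEdges (k : ℕ) (body : Program) : Program := forLoop (k + 18) (k + 19) (k + 7) body

theorem runs_forEdges {W k t M : ℕ} {body : Program} {R A : List ℕ} (J : ℕ → State → Prop)
    {σ : State} (hM : M ≤ W) (hW : 1 ≤ W) (hm : σ.reg (k + 7) = M) (h7 : k + 7 ∉ R)
    (h18 : k + 18 ∈ R) (h19 : k + 19 ∈ R)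
    (hJ : ∀ j σ x v, x = k + 18 ∨ x = k + 19 → J j σ → J j (σ.setReg x v))
    (hbody : ∀ j σ', j < M → Unchanged R A σ σ' → J j σ' → σ'.reg (k + 18) = j →
      Runs W body σ' t (fun σ'' => Unchanged R A σ' σ'' ∧ J (j + 1) σ'' ∧ σ''.reg (k + 18) = j))
    (h0 : J 0 σ) :
    Runs W (forEdges k body) σ ((t + 4) * M + 3) (fun σ' => Unchanged R A σ σ' ∧ J M σ') := by
  refine runs_forLoop (fun j σ' => Unchanged R A σ σ' ∧ J j σ') hM hW (by simp) (by simp) (by simp)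
    ?_ ?_ ?_ ?_ ⟨Unchanged.refl _ _ _, h0⟩
  · rintro j σ' ⟨h, -⟩
    rw [h.1 _ h7, hm]
  · rintro j σ' v ⟨h, h'⟩
    exact ⟨h.setReg h18 v, hJ _ _ _ _ (Or.inl rfl) h'⟩
  · rintro j σ' v ⟨h, h'⟩
    exact ⟨h.setReg h19 v, hJ _ _ _ _ (Or.inr rfl) h'⟩
  · rintro j σ' hj ⟨h, h'⟩ hi
    exact (hbody j σ' hj h h' hi).mono le_rfl
      (fun σ'' h'' => ⟨⟨h.trans h''.1, h''.2.1⟩, h''.2.2⟩)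

theorem forall_lt_succ_update {f g : ℤ → ℤ} {j : ℕ} {v : ℤ} (h : ∀ e : ℕ, e < j → f e = g e)
    (hv : v = g j) : ∀ e : ℕ, e < j + 1 → Function.update f (j : ℤ) v e = g e := by
  intro e he
  rcases Nat.lt_succ_iff_lt_or_eq.1 he with h1 | rfl
  · rw [Function.update_of_ne (by exact_mod_cast h1.ne)]
    exact h e h1
  · simpa using hv

/-- `arr dst := arr src`, for the entries that belong to edges. -/
def copyLoop (k src dst : ℕ) : Program :=
  forEdges k (block [.load (k + 20) src (k + 18), .store dst (k + 18) (k + 20)])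

theorem runs_copyLoop {W k M src dst : ℕ} {σ : State} (hM : M ≤ W) (hW : 1 ≤ W)
    (hm : σ.reg (k + 7) = M) (hne : src ≠ dst)
    (hb : ∀ e : ℕ, e < M → |σ.arr src e| ≤ (W : ℤ)) :
    Runs W (copyLoop k src dst) σ (6 * M + 3) (fun σ' =>
      Unchanged [k + 18, k + 19, k + 20, k + 21] [dst] σ σ' ∧
      ∀ e : ℕ, e < M → σ'.arr dst e = σ.arr src e) := by
  refine runs_forEdges (fun j σ' => ∀ e : ℕ, e < j → σ'.arr dst e = σ.arr src e) hM hW hm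
    (by simp) (by simp) (by simp) (fun j σ x v _ h => h) ?_ (by simp)
  intro j σ' hj hu hJ hi
  refine (runs_of_wp ?_).mono (le_of_eq rfl) (fun _ h => h)
  have hsrc : σ'.arr src = σ.arr src := hu.2 _ (by simpa using hne)
  have h1 := hb j hj
  simp only [block, wp, hi, State.reg_setReg, hsrc]
  refine ⟨h1, by simpa [hi] using h1, ?_, ?_, by simp [hi]⟩
  · exact ((Unchanged.refl _ _ _).setReg (by simp) _).setArr (by simp) _ _
  · simp only [State.arr_setArr, State.arr_setReg, if_true, if_neg (by simp : k + 18 ≠ k + 20)]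
    exact forall_lt_succ_update hJ rfl

theorem State.setReg_self (σ : State) (x : ℕ) : σ.setReg x (σ.reg x) = σ := by
  simp [State.setReg]

/-- `reg c := max (reg c) (reg x)`. -/
def maxInto (g c x : ℕ) : Program :=
  block [.arith .sub g x c, .cond g (.arith .add c c g) .nop]

theorem wp_maxInto {W g c x : ℕ} {σ : State} {Q : State → Prop} (hgc : g ≠ c)
    (h1 : |σ.reg x - σ.reg c| ≤ (W : ℤ)) (h2 : |σ.reg x| ≤ (W : ℤ))
    (h : Q ((σ.setReg g (σ.reg x - σ.reg c)).setReg c (max (σ.reg c) (σ.reg x)))) :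
    wp W (maxInto g c x) σ Q := by
  simp only [maxInto, block, wp, Op.eval, State.reg_setReg, if_true, if_neg hgc.symm]
  refine ⟨h1, fun hpos => ⟨by simpa using h2, ?_⟩, fun hneg => ?_⟩
  · rw [max_eq_right (by omega)] at h
    rwa [add_sub_cancel]
  · rw [max_eq_left (by omega)] at h
    have h3 := State.setReg_self (σ.setReg g (σ.reg x - σ.reg c)) c
    rw [State.reg_setReg, if_neg hgc.symm] at h3
    rwa [h3] at h

/-- `reg (k + 27) := max (reg (k + 27)) |c e| (b e)` for every edge `e`. -/
def maxLoop (k : ℕ) : Program :=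
  forEdges k (block [.load (k + 20) (k + 9) (k + 18), maxInto (k + 21) (k + 27) (k + 20),
    .const (k + 21) 0, .arith .sub (k + 20) (k + 21) (k + 20),
    maxInto (k + 21) (k + 27) (k + 20),
    .load (k + 20) (k + 10) (k + 18), maxInto (k + 21) (k + 27) (k + 20)])

theorem runs_maxLoop {W k M C : ℕ} {σ : State} (hM : M ≤ W) (hC : 1 ≤ C) (hCW : 2 * C ≤ W)
    (hm : σ.reg (k + 7) = M) (hinit : σ.reg (k + 27) = 1)
    (hcost : ∀ e : ℕ, e < M → |σ.arr (k + 9) e| ≤ (C : ℤ))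
    (hfee : ∀ e : ℕ, e < M → |σ.arr (k + 10) e| ≤ (C : ℤ)) :
    Runs W (maxLoop k) σ (17 * M + 3) (fun σ' =>
      Unchanged [k + 18, k + 19, k + 20, k + 21, k + 27] [] σ σ' ∧
      ∃ c : ℕ, σ'.reg (k + 27) = c ∧ 1 ≤ c ∧ c ≤ C ∧
        ∀ e : ℕ, e < M → |σ.arr (k + 9) e| ≤ (c : ℤ) ∧ σ.arr (k + 10) e ≤ (c : ℤ)) := by
  refine runs_forEdges (fun j σ' => ∃ c : ℕ, σ'.reg (k + 27) = c ∧ 1 ≤ c ∧ c ≤ C ∧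
        ∀ e : ℕ, e < j → |σ.arr (k + 9) e| ≤ (c : ℤ) ∧ σ.arr (k + 10) e ≤ (c : ℤ)) hM (by omega) hm
    (by simp) (by simp) (by simp) ?_ ?_ ⟨1, by simpa using hinit, le_rfl, hC, by simp⟩
  · rintro j σ' x v (rfl | rfl) ⟨c, h1, h2⟩
    · exact ⟨c, by simpa using h1, h2⟩
    · exact ⟨c, by simpa using h1, h2⟩
  rintro j σ' hj hu ⟨c, hc, hc1, hcC, hJ⟩ hi
  refine (runs_of_wp ?_).mono (le_of_eq rfl) (fun _ h => h)
  have h9 : σ'.arr (k + 9) = σ.arr (k + 9) := hu.2 _ (by simp)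
  have h10 : σ'.arr (k + 10) = σ.arr (k + 10) := hu.2 _ (by simp)
  have hcj := abs_le.1 (hcost j hj)
  have hfj := abs_le.1 (hfee j hj)
  simp only [block, wp, hi, h9]
  refine ⟨abs_le.2 (by omega), wp_maxInto (by simp) ?_ ?_ ?_⟩
  · simp [hc, abs_le]
    omega
  · simp [abs_le]
    omega
  simp only [Op.eval, State.reg_setReg, hc]
  simp
  refine ⟨?_, wp_maxInto (by simp) ?_ ?_ ?_⟩
  · rw [abs_le]
    omega
  · simp [abs_le]
    omega
  · simp [abs_le]
    omega
  simp [hi, h10]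
  refine ⟨abs_le.2 (by omega), wp_maxInto (by simp) ?_ ?_ ?_⟩
  · simp [abs_le]
    omega
  · simp [abs_le]
    omega
  simp [hi]
  constructor
  · refine Unchanged.setReg (Unchanged.setReg ?_ (by simp) _) (by simp) _
    refine Unchanged.setReg (Unchanged.setReg ?_ (by simp) _) (by simp) _
    refine Unchanged.setReg (Unchanged.setReg ?_ (by simp) _) (by simp) _
    refine Unchanged.setReg (Unchanged.setReg ?_ (by simp) _) (by simp) _
    refine Unchanged.setReg (Unchanged.setReg ?_ (by simp) _) (by simp) _
    exact Unchanged.refl _ _ _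
  · obtain ⟨d, hd⟩ := Int.eq_ofNat_of_zero_le (a := max (c : ℤ) (max (σ.arr (k + 9) j)
      (max (-σ.arr (k + 9) j) (σ.arr (k + 10) j)))) (by omega)
    refine ⟨d, hd, by omega, by omega, fun e he => ?_⟩
    rcases he.lt_or_eq with h1 | rfl
    · obtain ⟨h2, h3⟩ := hJ e h1
      rw [abs_le] at h2 ⊢
      omega
    · rw [abs_le]
      omega

/-- `arr 3 := D * c + j * b`, where `D` and `j` are held by the registers `k + 11` and `k + 22`. -/
def costLoop (k : ℕ) : Program :=
  forEdges k (block [.load (k + 20) (k + 9) (k + 18), .arith .mul (k + 20) (k + 11) (k + 20),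
    .load (k + 21) (k + 10) (k + 18), .arith .mul (k + 21) (k + 22) (k + 21),
    .arith .add (k + 20) (k + 20) (k + 21), .store 3 (k + 18) (k + 20)])

theorem runs_costLoop {W k M : ℕ} {σ : State} {D j : ℤ} (hM : M ≤ W) (hW : 1 ≤ W)
    (hm : σ.reg (k + 7) = M) (hD : σ.reg (k + 11) = D) (hj : σ.reg (k + 22) = j)
    (hb : ∀ e : ℕ, e < M → |σ.arr (k + 9) e| ≤ (W : ℤ) ∧ |D * σ.arr (k + 9) e| ≤ (W : ℤ) ∧
      |σ.arr (k + 10) e| ≤ (W : ℤ) ∧ |j * σ.arr (k + 10) e| ≤ (W : ℤ) ∧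
      |D * σ.arr (k + 9) e + j * σ.arr (k + 10) e| ≤ (W : ℤ)) :
    Runs W (costLoop k) σ (10 * M + 3) (fun σ' =>
      Unchanged [k + 18, k + 19, k + 20, k + 21] [3] σ σ' ∧
      ∀ e : ℕ, e < M → σ'.arr 3 e = D * σ.arr (k + 9) e + j * σ.arr (k + 10) e) := by
  refine runs_forEdges (fun i σ' => ∀ e : ℕ, e < i → σ'.arr 3 e =
    (fun i => D * σ.arr (k + 9) i + j * σ.arr (k + 10) i) e) hM hW hm
    (by simp) (by simp) (by simp) (fun j σ x v _ h => h) ?_ (by simp)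
  intro i σ' hi hu hJ hi'
  refine (runs_of_wp ?_).mono (le_of_eq rfl) (fun _ h => h)
  have h9 : σ'.arr (k + 9) = σ.arr (k + 9) := hu.2 _ (by simp)
  have h10 : σ'.arr (k + 10) = σ.arr (k + 10) := hu.2 _ (by simp)
  have h11 : σ'.reg (k + 11) = D := by rw [hu.1 _ (by simp), hD]
  have h22 : σ'.reg (k + 22) = j := by rw [hu.1 _ (by simp), hj]
  obtain ⟨b1, b2, b3, b4, b5⟩ := hb i hi
  simp [block, wp, Op.eval, hi', h9, h10, h11, h22]
  refine ⟨b1, by simpa [abs_mul] using b2, b3, by simpa [abs_mul] using b4, b5, ?_, ?_⟩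
  · refine Unchanged.setArr ?_ (by simp) _ _
    refine Unchanged.setReg (Unchanged.setReg ?_ (by simp) _) (by simp) _
    refine Unchanged.setReg (Unchanged.setReg ?_ (by simp) _) (by simp) _
    exact (Unchanged.refl _ _ _).setReg (by simp) _
  · intro e he
    have := forall_lt_succ_update (g := fun i => D * σ.arr (k + 9) i + j * σ.arr (k + 10) i)
      hJ rfl e (Nat.lt_succ_of_le he)
    simpa using this

/-- `reg (k + 23) := reg (k + 23) + ∑ e, b e * x e`, where `x` is the array `5`. -/
def sumLoop (k : ℕ) : Program :=
  forEdges k (block [.load (k + 20) (k + 10) (k + 18), .load (k + 21) 5 (k + 18),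
    .arith .mul (k + 20) (k + 20) (k + 21), .arith .add (k + 23) (k + 23) (k + 20)])

theorem runs_sumLoop {W k M : ℕ} {σ : State} (hM : M ≤ W) (hW : 1 ≤ W)
    (hm : σ.reg (k + 7) = M) (hinit : σ.reg (k + 23) = 0)
    (hb : ∀ e : ℕ, e < M → |σ.arr (k + 10) e| ≤ (W : ℤ) ∧ |σ.arr 5 e| ≤ (W : ℤ) ∧
      |σ.arr (k + 10) e * σ.arr 5 e| ≤ (W : ℤ))
    (hs : ∀ j : ℕ, j ≤ M → |∑ e ∈ Finset.range j, σ.arr (k + 10) e * σ.arr 5 e| ≤ (W : ℤ)) :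
    Runs W (sumLoop k) σ (8 * M + 3) (fun σ' =>
      Unchanged [k + 18, k + 19, k + 20, k + 21, k + 23] [] σ σ' ∧
      σ'.reg (k + 23) = ∑ e ∈ Finset.range M, σ.arr (k + 10) e * σ.arr 5 e) := by
  refine runs_forEdges (fun j σ' => σ'.reg (k + 23) =
    ∑ e ∈ Finset.range j, σ.arr (k + 10) e * σ.arr 5 e) hM hW hm
    (by simp) (by simp) (by simp) ?_ ?_ (by simpa using hinit)
  · rintro j σ x v (rfl | rfl) h
    · simpa using h
    · simpa using h
  intro i σ' hi hu hJ hi'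
  refine (runs_of_wp ?_).mono (le_of_eq rfl) (fun _ h => h)
  have h5 : σ'.arr 5 = σ.arr 5 := hu.2 _ (by simp)
  have h10 : σ'.arr (k + 10) = σ.arr (k + 10) := hu.2 _ (by simp)
  obtain ⟨b1, b2, b3⟩ := hb i hi
  have b4 := hs (i + 1) hi
  rw [Finset.sum_range_succ] at b4
  simp [block, wp, Op.eval, hi', h5, h10, hJ, Finset.sum_range_succ]
  refine ⟨b1, b2, by simpa [abs_mul] using b3, b4, ?_⟩
  refine Unchanged.setReg (Unchanged.setReg ?_ (by simp) _) (by simp) _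
  refine Unchanged.setReg (Unchanged.setReg ?_ (by simp) _) (by simp) _
  exact Unchanged.refl _ _ _

/-- `arr 5 := p * x + q * y`, where `p` and `q` are held by the registers `k + 25` and `k + 26`, and
`x` and `y` by the arrays `k + 11` and `k + 12`. -/
def combineLoop (k : ℕ) : Program :=
  forEdges k (block [.load (k + 20) (k + 11) (k + 18), .arith .mul (k + 20) (k + 25) (k + 20),
    .load (k + 21) (k + 12) (k + 18), .arith .mul (k + 21) (k + 26) (k + 21),
    .arith .add (k + 20) (k + 20) (k + 21), .store 5 (k + 18) (k + 20)])

theorem runs_combineLoop {W k M : ℕ} {σ : State} {p q : ℤ} (hM : M ≤ W) (hW : 1 ≤ W)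
    (hm : σ.reg (k + 7) = M) (hp : σ.reg (k + 25) = p) (hq : σ.reg (k + 26) = q)
    (hb : ∀ e : ℕ, e < M → |σ.arr (k + 11) e| ≤ (W : ℤ) ∧ |p * σ.arr (k + 11) e| ≤ (W : ℤ) ∧
      |σ.arr (k + 12) e| ≤ (W : ℤ) ∧ |q * σ.arr (k + 12) e| ≤ (W : ℤ) ∧
      |p * σ.arr (k + 11) e + q * σ.arr (k + 12) e| ≤ (W : ℤ)) :
    Runs W (combineLoop k) σ (10 * M + 3) (fun σ' =>
      Unchanged [k + 18, k + 19, k + 20, k + 21] [5] σ σ' ∧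
      ∀ e : ℕ, e < M → σ'.arr 5 e = p * σ.arr (k + 11) e + q * σ.arr (k + 12) e) := by
  refine runs_forEdges (fun i σ' => ∀ e : ℕ, e < i → σ'.arr 5 e =
    (fun i => p * σ.arr (k + 11) i + q * σ.arr (k + 12) i) e) hM hW hm
    (by simp) (by simp) (by simp) (fun j σ x v _ h => h) ?_ (by simp)
  intro i σ' hi hu hJ hi'
  refine (runs_of_wp ?_).mono (le_of_eq rfl) (fun _ h => h)
  have h11 : σ'.arr (k + 11) = σ.arr (k + 11) := hu.2 _ (by simp)
  have h12 : σ'.arr (k + 12) = σ.arr (k + 12) := hu.2 _ (by simp)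
  have h25 : σ'.reg (k + 25) = p := by rw [hu.1 _ (by simp), hp]
  have h26 : σ'.reg (k + 26) = q := by rw [hu.1 _ (by simp), hq]
  obtain ⟨b1, b2, b3, b4, b5⟩ := hb i hi
  simp [block, wp, Op.eval, hi', h11, h12, h25, h26]
  refine ⟨b1, by simpa [abs_mul] using b2, b3, by simpa [abs_mul] using b4, b5, ?_, ?_⟩
  · refine Unchanged.setArr ?_ (by simp) _ _
    refine Unchanged.setReg (Unchanged.setReg ?_ (by simp) _) (by simp) _
    refine Unchanged.setReg (Unchanged.setReg ?_ (by simp) _) (by simp) _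
    exact (Unchanged.refl _ _ _).setReg (by simp) _
  · intro e he
    have := forall_lt_succ_update (g := fun i => p * σ.arr (k + 11) i + q * σ.arr (k + 12) i)
      hJ rfl e (Nat.lt_succ_of_le he)
    simpa using this

/-! ### The program -/

/-- `reg x := reg y`, for `x ≠ y`. -/
def mov (x y : ℕ) : Program := block [.const x 0, .arith .add x x y]

theorem State.setReg_setReg (σ : State) (x : ℕ) (u v : ℤ) :
    (σ.setReg x u).setReg x v = σ.setReg x v := by
  simp [State.setReg]

theorem wp_mov {W x y : ℕ} (hxy : y ≠ x) {σ : State} {Q : State → Prop} :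
    wp W (mov x y) σ Q ↔ |σ.reg y| ≤ (W : ℤ) ∧ Q (σ.setReg x (σ.reg y)) := by
  simp [mov, block, wp, Op.eval, hxy, State.setReg_setReg]

/-- The number of grid points that are still strictly between the two ends of the search interval
goes to register `k + 24`. -/
def setGuard (k : ℕ) : Program :=
  block [.arith .sub (k + 24) (k + 13) (k + 12), .const (k + 20) 1,
    .arith .sub (k + 24) (k + 24) (k + 20)]

/-- Saves the input in the registers `k + 6` (nodes), `k + 7` (edges), `k + 8` (source), `k + 9`
(sink), `k + 10` (budget), and in the arrays `k + 6` (tails), `k + 7` (heads), `k + 8` (capacities),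
`k + 9` (costs), `k + 10` (fees). The array `k + 11` only has to hold small numbers. -/
def saveInput (k : ℕ) : Program :=
  block [
    block [mov (k + 6) 0, mov (k + 7) 1, mov (k + 8) 2, mov (k + 9) 3, mov (k + 10) 4],
    copyLoop k 0 (k + 6), copyLoop k 1 (k + 7), copyLoop k 2 (k + 8), copyLoop k 3 (k + 9),
    copyLoop k 4 (k + 10), copyLoop k 2 (k + 11)]

/-- Saves the input and prepares the search. With `C₀` the maximum of `1`, the absolute costs and
the fees, and `N₀ = 2 * n * C₀`, the denominator `D = N₀ ^ 2` of the multipliers goes to register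
`k + 11`, and the ends `-1` and `N₀ ^ 3 + 1` of the search interval to the registers `k + 12` and
`k + 13`. -/
def prologue (k : ℕ) : Program :=
  block [saveInput k, .const (k + 27) 1, maxLoop k,
    block [.const (k + 20) 2, .arith .mul (k + 20) (k + 20) (k + 6),
      .arith .mul (k + 20) (k + 20) (k + 27), .arith .mul (k + 11) (k + 20) (k + 20),
      .arith .mul (k + 13) (k + 11) (k + 20), .const (k + 12) 1,
      .arith .add (k + 13) (k + 13) (k + 12), .const (k + 12) (-1)],
    setGuard k]

/-- Runs `A` on the saved network with the costs `D * c + j * b`, where `j` is held by register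
`k + 22`, and puts the fee of the solution (times its denominator) into register `k + 23`. The
output register of `A` is cleared first, so that it holds a number that fits into a word of `A`
afterwards. -/
def solveScaled (A : Program) (k : ℕ) : Program :=
  block [
    block [mov 0 (k + 6), mov 1 (k + 7), mov 2 (k + 8), mov 3 (k + 9), .const 5 0],
    copyLoop k (k + 6) 0, copyLoop k (k + 7) 1, copyLoop k (k + 8) 2, costLoop k, A,
    .const (k + 23) 0, sumLoop k]

/-- Records the solution found last: its multiplier, denominator, fee and numerators go to the
registers `x`, `d`, `f` and to the array `a`. -/
def record (k x d f a : ℕ) : Program :=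
  block [copyLoop k 5 a, block [mov x (k + 22), mov d 5, mov f (k + 23)]]

/-- One round of the binary search: solve for the multiplier in the middle of the interval, compare
the fee with the budget, and continue in one half. -/
def searchStep (A : Program) (k : ℕ) : Program :=
  block [
    block [.arith .add (k + 22) (k + 12) (k + 13), .const (k + 20) 2,
      .arith .div (k + 22) (k + 22) (k + 20)],
    solveScaled A k,
    block [.arith .mul (k + 20) (k + 10) 5, .arith .sub (k + 20) (k + 23) (k + 20)],
    .cond (k + 20) (record k (k + 12) (k + 14) (k + 15) (k + 11))
      (record k (k + 13) (k + 16) (k + 17) (k + 12)),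
    setGuard k]

/-- Outputs the convex combination of the two solutions whose fee is the budget, or the right one
alone if the multiplier `0` needs no correction. -/
def epilogue (k : ℕ) : Program :=
  block [
    block [.const (k + 20) 1, .arith .add (k + 20) (k + 20) (k + 12),
      .cond (k + 20)
        (block [.arith .mul (k + 25) (k + 10) (k + 16), .arith .sub (k + 25) (k + 25) (k + 17),
          .arith .mul (k + 26) (k + 10) (k + 14), .arith .sub (k + 26) (k + 15) (k + 26),
          .arith .mul (k + 20) (k + 15) (k + 16), .arith .mul (k + 21) (k + 17) (k + 14),
          .arith .sub 5 (k + 20) (k + 21)])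
        (block [.const (k + 25) 0, .const (k + 26) 1, mov 5 (k + 16)])],
    combineLoop k]

/-- The program for the budget-constrained problem: binary search for the Lagrange multiplier. -/
def budgetProgram (A : Program) (k : ℕ) : Program :=
  block [prologue k, .loop (k + 24) (searchStep A k), epilogue k]

/-! ### Correctness of the parts -/

theorem runs_block_cons {W s t : ℕ} {P : Program} {l : List Program} {σ : State}
    {Q R : State → Prop} (h : Runs W P σ t Q) (hts : t ≤ s)
    (h' : ∀ σ', Q σ' → Runs W (block l) σ' (s - t) R) : Runs W (block (P :: l)) σ s R :=
  (h.seq h').mono (by omega) (fun _ h => h)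

theorem runs_block_nil {W s : ℕ} {σ : State} {Q : State → Prop} (h : Q σ) :
    Runs W (block []) σ s Q :=
  ⟨σ, 0, .nop σ, Nat.zero_le _, h⟩

theorem runs_block_wp {W s : ℕ} {P : Program} {l : List Program} {σ : State} (t : ℕ)
    (Q : State → Prop) {R : State → Prop} (ht : steps P = t) (hts : t ≤ s) (h : wp W P σ Q)
    (h' : ∀ σ', Q σ' → Runs W (block l) σ' (s - t) R) : Runs W (block (P :: l)) σ s R :=
  runs_block_cons (ht ▸ runs_of_wp h) hts h'

/-- The saved copy of the instance. -/
structure SavedIn (N : BudgetNetwork) (k : ℕ) (σ : State) : Prop where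
  n : σ.reg (k + 6) = N.n
  m : σ.reg (k + 7) = N.m
  s : σ.reg (k + 8) = (N.s : ℕ)
  t : σ.reg (k + 9) = (N.t : ℕ)
  budget : σ.reg (k + 10) = N.budget
  tail : ∀ e : Fin N.m, σ.arr (k + 6) (e : ℕ) = (N.tail e : ℕ)
  head : ∀ e : Fin N.m, σ.arr (k + 7) (e : ℕ) = (N.head e : ℕ)
  cap : ∀ e : Fin N.m, σ.arr (k + 8) (e : ℕ) = N.cap e
  cost : ∀ e : Fin N.m, σ.arr (k + 9) (e : ℕ) = N.cost e
  fee : ∀ e : Fin N.m, σ.arr (k + 10) (e : ℕ) = N.fee e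

theorem SavedIn.of_eq {N : BudgetNetwork} {k : ℕ} {σ σ' : State} (h : SavedIn N k σ)
    (hr : ∀ r, k + 6 ≤ r → r ≤ k + 10 → σ'.reg r = σ.reg r)
    (ha : ∀ a, k + 6 ≤ a → a ≤ k + 10 → σ'.arr a = σ.arr a) : SavedIn N k σ' where
  n := by rw [hr _ (by omega) (by omega), h.n]
  m := by rw [hr _ (by omega) (by omega), h.m]
  s := by rw [hr _ (by omega) (by omega), h.s]
  t := by rw [hr _ (by omega) (by omega), h.t]
  budget := by rw [hr _ (by omega) (by omega), h.budget]
  tail := by rw [ha _ (by omega) (by omega)]; exact h.tail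
  head := by rw [ha _ (by omega) (by omega)]; exact h.head
  cap := by rw [ha _ (by omega) (by omega)]; exact h.cap
  cost := by rw [ha _ (by omega) (by omega)]; exact h.cost
  fee := by rw [ha _ (by omega) (by omega)]; exact h.fee

theorem SavedIn.unchanged {N : BudgetNetwork} {k : ℕ} {σ σ' : State} {R A : List ℕ}
    (h : SavedIn N k σ) (hu : Unchanged R A σ σ') (hR : ∀ r ∈ R, r < k + 6 ∨ k + 10 < r)
    (hA : ∀ a ∈ A, a < k + 6 ∨ k + 10 < a) : SavedIn N k σ' := by
  refine h.of_eq (fun r h1 h2 => hu.1 r (fun hr => ?_)) (fun a h1 h2 => hu.2 a (fun ha => ?_))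
  · rcases hR r hr with h | h <;> omega
  · rcases hA a ha with h | h <;> omega

/-- The numerators `a`, the denominator `d` and the fee `β` (times `d`) of an optimum solution of
the Lagrangian relaxation for the multiplier `j / D`; the denominator is at most `Y`. -/
structure IsSolution (N : BudgetNetwork) (D j : ℤ) (Y : ℕ) (a : ℤ → ℤ) (d β : ℤ) : Prop where
  pos : 0 < d
  le : d ≤ Y
  opt : N.IsLagrangeOptimal ((j : ℝ) / D) (fun e => (a (e : ℕ) : ℝ) / d)
  fee : β = ∑ e : Fin N.m, (N.fee e : ℤ) * a (e : ℕ)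

theorem num_bounds_of_isFlow {N : Network} {a : ℤ → ℤ} {d : ℤ} {G Y : ℕ} (hd : 0 < d) (hdY : d ≤ Y)
    (hcap : ∀ e, N.cap e ≤ G) (hx : N.IsFlow (fun e => (a (e : ℕ) : ℝ) / d)) (e : Fin N.m) :
    0 ≤ a (e : ℕ) ∧ a (e : ℕ) ≤ G * Y := by
  have hdr : (0 : ℝ) < d := by exact_mod_cast hd
  obtain ⟨h1, h2⟩ := hx.2 e
  rw [le_div_iff₀ hdr, zero_mul] at h1
  rw [div_le_iff₀ hdr] at h2
  have h2' : a (e : ℕ) ≤ N.cap e * d := by exact_mod_cast h2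
  refine ⟨by exact_mod_cast h1, h2'.trans (mul_le_mul ?_ hdY hd.le (Nat.cast_nonneg _))⟩
  exact_mod_cast hcap e

theorem sum_fee_bounds {N : BudgetNetwork} {a : ℤ → ℤ} {G Y : ℕ} (hfee : ∀ e, N.fee e ≤ G)
    (ha : ∀ e : Fin N.m, 0 ≤ a (e : ℕ) ∧ a (e : ℕ) ≤ G * Y) (S : Finset (Fin N.m))
    (hm : N.m ≤ G) :
    0 ≤ ∑ e ∈ S, (N.fee e : ℤ) * a (e : ℕ) ∧
      ∑ e ∈ S, (N.fee e : ℤ) * a (e : ℕ) ≤ G ^ 3 * Y := by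
  refine ⟨Finset.sum_nonneg (fun e _ => mul_nonneg (Nat.cast_nonneg _) (ha e).1), ?_⟩
  have hterm : ∀ e ∈ S, (N.fee e : ℤ) * a (e : ℕ) ≤ G * (G * Y) := fun e _ =>
    mul_le_mul (by exact_mod_cast hfee e) (ha e).2 (ha e).1 (Nat.cast_nonneg _)
  refine (Finset.sum_le_card_nsmul S _ _ hterm).trans ?_
  rw [nsmul_eq_mul]
  have hcard : (S.card : ℤ) ≤ G := by
    have := Finset.card_le_univ S
    rw [Fintype.card_fin] at this
    exact_mod_cast this.trans hm
  calc (S.card : ℤ) * (G * (G * Y)) ≤ G * (G * (G * Y)) :=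
        mul_le_mul_of_nonneg_right hcard (by positivity)
    _ = G ^ 3 * Y := by ring

theorem IsSolution.num_bounds {N : BudgetNetwork} {D j d β : ℤ} {Y G : ℕ} {a : ℤ → ℤ}
    (h : IsSolution N D j Y a d β) (hcap : ∀ e, N.cap e ≤ G) (e : Fin N.m) :
    0 ≤ a (e : ℕ) ∧ a (e : ℕ) ≤ G * Y :=
  num_bounds_of_isFlow h.pos h.le hcap h.opt.1 e

theorem IsSolution.fee_bounds {N : BudgetNetwork} {D j d β : ℤ} {Y G : ℕ} {a : ℤ → ℤ}
    (h : IsSolution N D j Y a d β) (hcap : ∀ e, N.cap e ≤ G) (hfee : ∀ e, N.fee e ≤ G)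
    (hm : N.m ≤ G) : 0 ≤ β ∧ β ≤ G ^ 3 * Y := by
  rw [h.fee]
  exact sum_fee_bounds hfee (h.num_bounds hcap) _ hm

theorem IsSolution.totalFee_eq {N : BudgetNetwork} {D j d β : ℤ} {Y : ℕ} {a : ℤ → ℤ}
    (h : IsSolution N D j Y a d β) :
    N.totalFee (fun e => (a (e : ℕ) : ℝ) / d) = (β : ℝ) / d := by
  rw [h.fee]
  push_cast
  rw [BudgetNetwork.totalFee, Finset.sum_div]
  exact Finset.sum_congr rfl (fun e _ => by ring)

theorem IsSolution.congr {N : BudgetNetwork} {D j d β : ℤ} {Y : ℕ} {a a' : ℤ → ℤ}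
    (h : IsSolution N D j Y a d β) (ha : ∀ e : ℕ, e < N.m → a' e = a e) :
    IsSolution N D j Y a' d β := by
  have h1 : ∀ e : Fin N.m, a' (e : ℕ) = a (e : ℕ) := fun e => ha e e.2
  refine ⟨h.pos, h.le, ?_, ?_⟩
  · simpa only [h1] using h.opt
  · simpa only [h1] using h.fee

/-- Standing assumptions on an instance, on the bound `C₀` for costs and fees that the program
computes, on `G`, a common bound for all numbers of the input, on `Y`, the size of the words that
`A` uses, and on `W`, the size of the words that are available. -/
structure Setting (N : BudgetNetwork) (C₀ U G Y W : ℕ) : Prop where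
  one_le_C₀ : 1 ≤ C₀
  cost_le : ∀ e, |N.cost e| ≤ (C₀ : ℤ)
  fee_le : ∀ e, N.fee e ≤ C₀
  cap_le : ∀ e, N.cap e ≤ U
  n_le : N.n ≤ G
  m_le : N.m ≤ G
  C₀_le : C₀ ≤ G
  U_le : U ≤ G
  budget_le : N.budget ≤ G
  two_le_G : 2 ≤ G
  one_le_Y : 1 ≤ Y
  pow_le_W : (2 * N.n * C₀) ^ 4 ≤ W
  mul_le_W : G ^ 5 * Y ^ 2 ≤ W

namespace Setting

variable {N : BudgetNetwork} {C₀ U G Y W : ℕ}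

theorem one_le_n (N : BudgetNetwork) : 1 ≤ N.n := Nat.one_le_of_lt N.s.2

theorem two_le (h : Setting N C₀ U G Y W) : 2 * C₀ ≤ 2 * N.n * C₀ := by
  have := one_le_n N
  have := h.one_le_C₀
  nlinarith

theorem pow_mul_le_W (h : Setting N C₀ U G Y W) {i j : ℕ} (hi : i ≤ 5) (hj : j ≤ 2) :
    (G : ℤ) ^ i * (Y : ℤ) ^ j ≤ W := by
  have h1 := h.two_le_G
  have h2 := h.one_le_Y
  have h3 := (Nat.mul_le_mul (Nat.pow_le_pow_right (by omega : 0 < G) hi)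
    (Nat.pow_le_pow_right h2 hj)).trans h.mul_le_W
  exact_mod_cast h3

theorem G_le_W (h : Setting N C₀ U G Y W) : (G : ℤ) ≤ W := by
  simpa using h.pow_mul_le_W (i := 1) (j := 0) (by omega) (by omega)

theorem scaled_bounds (h : Setting N C₀ U G Y W) {j : ℤ} (hj0 : 0 ≤ j)
    (hj : j ≤ ((2 * N.n * C₀ : ℕ) : ℤ) ^ 3) (e : Fin N.m) :
    |((2 * N.n * C₀ : ℕ) : ℤ) ^ 2 * N.cost e| ≤ ((2 * N.n * C₀ : ℕ) : ℤ) ^ 4 ∧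
    |j * (N.fee e : ℤ)| ≤ ((2 * N.n * C₀ : ℕ) : ℤ) ^ 4 ∧
    |((2 * N.n * C₀ : ℕ) : ℤ) ^ 2 * N.cost e + j * (N.fee e : ℤ)|
      ≤ ((2 * N.n * C₀ : ℕ) : ℤ) ^ 4 := by
  have h1 := h.cost_le e
  have h2 : (N.fee e : ℤ) ≤ C₀ := by exact_mod_cast h.fee_le e
  have h3 : 2 * (C₀ : ℤ) ≤ (2 * N.n * C₀ : ℕ) := by exact_mod_cast h.two_le
  have h4 : (1 : ℤ) ≤ C₀ := by exact_mod_cast h.one_le_C₀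
  have h5 : (0 : ℤ) ≤ N.fee e := Nat.cast_nonneg _
  generalize ((2 * N.n * C₀ : ℕ) : ℤ) = N₀ at *
  have a1 : 2 * |N₀ ^ 2 * N.cost e| ≤ N₀ ^ 4 := by
    rw [abs_mul, abs_of_nonneg (sq_nonneg N₀)]
    have : N₀ ^ 2 * (2 * |N.cost e|) ≤ N₀ ^ 2 * N₀ ^ 2 :=
      mul_le_mul_of_nonneg_left (by nlinarith) (sq_nonneg _)
    linarith [show N₀ ^ 2 * N₀ ^ 2 = N₀ ^ 4 by ring]
  have a2 : 2 * |j * (N.fee e : ℤ)| ≤ N₀ ^ 4 := by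
    rw [abs_of_nonneg (mul_nonneg hj0 h5)]
    have : j * (2 * (N.fee e : ℤ)) ≤ N₀ ^ 3 * N₀ :=
      mul_le_mul hj (by linarith) (by positivity) (hj0.trans hj)
    linarith [show N₀ ^ 3 * N₀ = N₀ ^ 4 by ring]
  have a3 := abs_add_le (N₀ ^ 2 * N.cost e) (j * (N.fee e : ℤ))
  have a4 := abs_nonneg (N₀ ^ 2 * N.cost e)
  have a5 := abs_nonneg (j * (N.fee e : ℤ))
  exact ⟨by linarith, by linarith, by linarith⟩

end Setting

theorem runs_setGuard {W k : ℕ} {σ : State} (hW : 1 ≤ W)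
    (h1 : |σ.reg (k + 13) - σ.reg (k + 12)| ≤ (W : ℤ))
    (h2 : |σ.reg (k + 13) - σ.reg (k + 12) - 1| ≤ (W : ℤ)) :
    Runs W (setGuard k) σ 3 (fun σ' => Unchanged [k + 20, k + 24] [] σ σ' ∧
      σ'.reg (k + 24) = σ.reg (k + 13) - σ.reg (k + 12) - 1) := by
  refine (runs_of_wp ?_).mono (le_of_eq rfl) (fun _ h => h)
  have hW' : (1 : ℤ) ≤ W := by exact_mod_cast hW
  simp [setGuard, block, wp, Op.eval]
  refine ⟨h1, by omega, h2, ?_⟩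
  refine Unchanged.setReg (Unchanged.setReg ?_ (by simp) _) (by simp) _
  exact (Unchanged.refl _ _ _).setReg (by simp) _

theorem forall_fin_of_copy {m : ℕ} {a a' : ℤ → ℤ} {f : Fin m → ℤ}
    (h : ∀ e : ℕ, e < m → a' e = a e) (ha : ∀ e : Fin m, a (e : ℕ) = f e) (e : Fin m) :
    a' (e : ℕ) = f e := (h e e.2).trans (ha e)

theorem forall_abs_le_of_fin {m : ℕ} {a : ℤ → ℤ} {f : Fin m → ℤ} {K : ℤ}
    (ha : ∀ e : Fin m, a (e : ℕ) = f e) (hf : ∀ e, |f e| ≤ K) (e : ℕ) (he : e < m) :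
    |a e| ≤ K := by
  rw [ha ⟨e, he⟩]
  exact hf _

theorem abs_natCast_le {a b : ℕ} (h : a ≤ b) : |(a : ℤ)| ≤ (b : ℤ) := by
  rw [abs_of_nonneg (Nat.cast_nonneg _)]
  exact_mod_cast h

theorem runs_saveInput {N : BudgetNetwork} {C U G W k : ℕ} {σ : State} (hσ : N.StoredIn σ)
    (hcost : ∀ e, |N.cost e| ≤ (C : ℤ)) (hfee : ∀ e, N.fee e ≤ C)
    (hcap : ∀ e, N.cap e ≤ U) (hn : N.n ≤ G) (hm : N.m ≤ G) (hCG : C ≤ G) (hU : U ≤ G)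
    (hB : N.budget ≤ G) (hGW : 2 * G ≤ W) :
    Runs W (saveInput k) σ (36 * N.m + 28) (fun σ' => SavedIn N k σ' ∧
      ∀ e : Fin N.m, |σ'.arr (k + 11) (e : ℕ)| ≤ (U : ℤ)) := by
  obtain ⟨⟨r0, r1, r2, r3, harr⟩, r4, h4⟩ := hσ
  have h0 : ∀ e : Fin N.m, σ.arr 0 (e : ℕ) = (N.tail e : ℕ) := fun e => (harr e).1
  have h1 : ∀ e : Fin N.m, σ.arr 1 (e : ℕ) = (N.head e : ℕ) := fun e => (harr e).2.1
  have h2 : ∀ e : Fin N.m, σ.arr 2 (e : ℕ) = N.cap e := fun e => (harr e).2.2.1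
  have h3 : ∀ e : Fin N.m, σ.arr 3 (e : ℕ) = N.cost e := fun e => (harr e).2.2.2
  have hmW : N.m ≤ W := by omega
  have hW : 1 ≤ W := by
    have := Setting.one_le_n N
    omega
  refine runs_block_wp 10 (fun σ' => σ'.arr = σ.arr ∧ σ'.reg (k + 6) = N.n ∧ σ'.reg (k + 7) = N.m ∧
    σ'.reg (k + 8) = (N.s : ℕ) ∧ σ'.reg (k + 9) = (N.t : ℕ) ∧ σ'.reg (k + 10) = N.budget) rfl
    (by omega) ?_ ?_
  · have b2 := N.s.2
    have b3 := N.t.2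
    simp [block, wp, wp_mov, r0, r1, r2, r3, r4]
    omega
  rintro σ₁ ⟨ha1, s6, s7, s8, s9, s10⟩
  refine runs_block_cons (runs_copyLoop hmW hW s7 (by omega) (by
    rw [ha1]; exact forall_abs_le_of_fin h0 (fun e => abs_natCast_le (by
      have := (N.tail e).2; omega)))) (by omega) ?_
  rintro σ₂ ⟨u2, c2⟩
  rw [ha1] at c2
  refine runs_block_cons (runs_copyLoop hmW hW (by rw [u2.1 _ (by simp), s7]) (by omega) (by
    rw [u2.2 _ (by simp), ha1]; exact forall_abs_le_of_fin h1 (fun e => abs_natCast_le (by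
      have := (N.head e).2; omega)))) (by omega) ?_
  rintro σ₃ ⟨u3, c3⟩
  rw [u2.2 _ (by simp), ha1] at c3
  refine runs_block_cons (runs_copyLoop hmW hW
    (by rw [u3.1 _ (by simp), u2.1 _ (by simp), s7]) (by omega) (by
    rw [u3.2 _ (by simp), u2.2 _ (by simp), ha1]
    exact forall_abs_le_of_fin h2 (fun e => abs_natCast_le (by
      have := hcap e; omega)))) (by omega) ?_
  rintro σ₄ ⟨u4, c4⟩
  rw [u3.2 _ (by simp), u2.2 _ (by simp), ha1] at c4
  refine runs_block_cons (runs_copyLoop hmW hW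
    (by rw [u4.1 _ (by simp), u3.1 _ (by simp), u2.1 _ (by simp), s7]) (by omega) (by
    rw [u4.2 _ (by simp), u3.2 _ (by simp), u2.2 _ (by simp), ha1]
    exact forall_abs_le_of_fin h3 (fun e => by
      have := hcost e; omega))) (by omega) ?_
  rintro σ₅ ⟨u5, c5⟩
  rw [u4.2 _ (by simp), u3.2 _ (by simp), u2.2 _ (by simp), ha1] at c5
  refine runs_block_cons (runs_copyLoop hmW hW
    (by rw [u5.1 _ (by simp), u4.1 _ (by simp), u3.1 _ (by simp), u2.1 _ (by simp), s7])
    (by omega) (by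
    rw [u5.2 _ (by simp), u4.2 _ (by simp), u3.2 _ (by simp), u2.2 _ (by simp), ha1]
    exact forall_abs_le_of_fin h4 (fun e => abs_natCast_le (by
      have := hfee e; omega)))) (by omega) ?_
  rintro σ₆ ⟨u6, c6⟩
  rw [u5.2 _ (by simp), u4.2 _ (by simp), u3.2 _ (by simp), u2.2 _ (by simp), ha1] at c6
  have hreg : ∀ r, r < k + 18 → σ₆.reg r = σ₁.reg r := by
    intro r hr
    have hr' : r ∉ [k + 18, k + 19, k + 20, k + 21] := by
      simp
      omega
    rw [u6.1 _ hr', u5.1 _ hr', u4.1 _ hr', u3.1 _ hr', u2.1 _ hr']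
  have hsaved : SavedIn N k σ₆ :=
    { n := by rw [hreg _ (by omega), s6]
      m := by rw [hreg _ (by omega), s7]
      s := by rw [hreg _ (by omega), s8]
      t := by rw [hreg _ (by omega), s9]
      budget := by rw [hreg _ (by omega), s10]
      tail := by
        rw [u6.2 _ (by simp), u5.2 _ (by simp), u4.2 _ (by simp), u3.2 _ (by simp)]
        exact forall_fin_of_copy c2 h0
      head := by
        rw [u6.2 _ (by simp), u5.2 _ (by simp), u4.2 _ (by simp)]
        exact forall_fin_of_copy c3 h1
      cap := by
        rw [u6.2 _ (by simp), u5.2 _ (by simp)]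
        exact forall_fin_of_copy c4 h2
      cost := by
        rw [u6.2 _ (by simp)]
        exact forall_fin_of_copy c5 h3
      fee := forall_fin_of_copy c6 h4 }
  have hcap6 : σ₆.arr 2 = σ.arr 2 := by
    rw [u6.2 _ (by simp), u5.2 _ (by simp), u4.2 _ (by simp), u3.2 _ (by simp), u2.2 _ (by simp),
      ha1]
  refine runs_block_cons (runs_copyLoop hmW hW hsaved.m (by omega) (by
    rw [hcap6]; exact forall_abs_le_of_fin h2 (fun e => abs_natCast_le (by
      have := hcap e; omega)))) (by omega) ?_
  rintro σ₇ ⟨u7, c7⟩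
  rw [hcap6] at c7
  have hsaved7 : SavedIn N k σ₇ := hsaved.unchanged u7 (by simp) (by simp)
  have hcap7 : ∀ e : Fin N.m, |σ₇.arr (k + 11) (e : ℕ)| ≤ (U : ℤ) := fun e => by
    rw [forall_fin_of_copy c7 h2]
    exact abs_natCast_le (hcap e)
  exact runs_block_nil ⟨hsaved7, hcap7⟩

theorem pow_chain {N₀ : ℤ} (h : 2 ≤ N₀) :
    N₀ ≤ N₀ ^ 2 ∧ 2 * N₀ ^ 2 ≤ N₀ ^ 3 ∧ 2 * N₀ ^ 3 ≤ N₀ ^ 4 := by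
  have p1 : 0 ≤ N₀ := by omega
  exact ⟨by nlinarith, by nlinarith [sq_nonneg N₀], by nlinarith [pow_nonneg p1 3]⟩

theorem runs_prologue {N : BudgetNetwork} {C U G W k : ℕ} {σ : State} (hσ : N.StoredIn σ)
    (hC : 1 ≤ C) (hcost : ∀ e, |N.cost e| ≤ (C : ℤ)) (hfee : ∀ e, N.fee e ≤ C)
    (hcap : ∀ e, N.cap e ≤ U) (hn : N.n ≤ G) (hm : N.m ≤ G) (hCG : C ≤ G) (hU : U ≤ G)
    (hB : N.budget ≤ G) (hGW : 2 * G ≤ W) (hpow : (2 * N.n * C) ^ 4 ≤ W) :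
    Runs W (prologue k) σ (53 * N.m + 60) (fun σ' => SavedIn N k σ' ∧
      (∀ e : Fin N.m, |σ'.arr (k + 11) (e : ℕ)| ≤ (U : ℤ)) ∧
      ∃ C₀ : ℕ, 1 ≤ C₀ ∧ C₀ ≤ C ∧ (∀ e, |N.cost e| ≤ (C₀ : ℤ)) ∧ (∀ e, N.fee e ≤ C₀) ∧
        σ'.reg (k + 11) = ((2 * N.n * C₀ : ℕ) : ℤ) ^ 2 ∧ σ'.reg (k + 12) = -1 ∧
        σ'.reg (k + 13) = ((2 * N.n * C₀ : ℕ) : ℤ) ^ 3 + 1 ∧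
        σ'.reg (k + 24) = ((2 * N.n * C₀ : ℕ) : ℤ) ^ 3 + 1) := by
  have hmW : N.m ≤ W := by omega
  have hW : 1 ≤ W := by omega
  have hW' : (1 : ℤ) ≤ W := by exact_mod_cast hW
  refine runs_block_cons (runs_saveInput (k := k) hσ hcost hfee hcap hn hm hCG hU hB hGW)
    (by omega) ?_
  rintro σ₇ ⟨hsaved7, hcap7⟩
  refine runs_block_wp 1 (fun σ' => Unchanged [k + 27] [] σ₇ σ' ∧ σ'.reg (k + 27) = 1) rfl
    (by omega) ⟨by simpa using hW', (Unchanged.refl _ _ _).setReg (by simp) _, by simp⟩ ?_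
  rintro σ₈ ⟨u8, s27⟩
  have hsaved8 : SavedIn N k σ₈ := hsaved7.unchanged u8 (by simp) (by simp)
  refine runs_block_cons (runs_maxLoop (C := C) hmW hC (by omega) hsaved8.m s27
    (forall_abs_le_of_fin hsaved8.cost hcost)
    (forall_abs_le_of_fin hsaved8.fee (fun e => abs_natCast_le (hfee e))))
    (by omega) ?_
  rintro σ₉ ⟨u9, C₀, s27', hC₀, hC₀C, hbound⟩
  have hsaved9 : SavedIn N k σ₉ := hsaved8.unchanged u9 (by simp) (by simp)
  have hcost₀ : ∀ e, |N.cost e| ≤ (C₀ : ℤ) := fun e => by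
    rw [← hsaved8.cost e]
    exact (hbound e e.2).1
  have hfee₀ : ∀ e, N.fee e ≤ C₀ := fun e => by
    have := (hbound e e.2).2
    rw [hsaved8.fee e] at this
    exact_mod_cast this
  have hN₀ : 2 ≤ 2 * N.n * C₀ := by
    have := Setting.one_le_n N
    nlinarith
  have hpow₀ : (((2 * N.n * C₀ : ℕ) : ℤ)) ^ 4 ≤ W := by
    have : (2 * N.n * C₀) ^ 4 ≤ W :=
      (Nat.pow_le_pow_left (Nat.mul_le_mul_left _ hC₀C) 4).trans hpow
    exact_mod_cast this
  obtain ⟨N₀, hN₀def⟩ : ∃ N₀ : ℤ, N₀ = ((2 * N.n * C₀ : ℕ) : ℤ) := ⟨_, rfl⟩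
  rw [← hN₀def] at hpow₀
  have hN₀2 : 2 ≤ N₀ := by
    rw [hN₀def]
    exact_mod_cast hN₀
  obtain ⟨p2, p3, p4⟩ := pow_chain hN₀2
  have e1 : 2 * (N.n : ℤ) * C₀ = N₀ := by
    rw [hN₀def]
    push_cast
    ring
  have e2 : N₀ * N₀ = N₀ ^ 2 := by ring
  have e3 : N₀ ^ 2 * N₀ = N₀ ^ 3 := by ring
  refine runs_block_wp 8 (fun σ' => Unchanged [k + 11, k + 12, k + 13, k + 20] [] σ₉ σ' ∧
    σ'.reg (k + 11) = N₀ ^ 2 ∧ σ'.reg (k + 12) = -1 ∧ σ'.reg (k + 13) = N₀ ^ 3 + 1) rfl (by omega) ?_ ?_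
  · simp only [block, wp, Op.eval, State.reg_setReg, Nat.reduceEqDiff, if_true, if_false,
      hsaved9.n, s27', e1, e2, e3, Nat.add_left_cancel_iff]
    have hn2 : 2 * (N.n : ℤ) ≤ N₀ := by
      rw [← e1]
      have : (1 : ℤ) ≤ C₀ := by exact_mod_cast hC₀
      nlinarith
    have q2 := sq_nonneg N₀
    refine ⟨?_, ?_, ?_, ?_, ?_, ?_, ?_, ?_, ?_⟩ <;> try (rw [abs_le]; omega)
    refine ⟨?_, trivial, trivial, trivial⟩
    refine Unchanged.setReg (Unchanged.setReg ?_ (by simp) _) (by simp) _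
    refine Unchanged.setReg (Unchanged.setReg ?_ (by simp) _) (by simp) _
    refine Unchanged.setReg (Unchanged.setReg ?_ (by simp) _) (by simp) _
    refine Unchanged.setReg (Unchanged.setReg ?_ (by simp) _) (by simp) _
    exact Unchanged.refl _ _ _
  rintro σ₁₀ ⟨u10, s11, s12, s13⟩
  refine runs_block_cons (runs_setGuard hW (by rw [s12, s13, abs_le]; omega)
    (by rw [s12, s13, abs_le]; omega)) (by omega) ?_
  rintro σ₁₁ ⟨u11, s24⟩
  rw [s12, s13] at s24
  rw [hN₀def] at s11 s13 s24
  refine runs_block_nil ⟨(hsaved9.unchanged u10 (by simp) (by simp)).unchanged u11 (by simp)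
    (by simp), ?_, C₀, hC₀, hC₀C, hcost₀, hfee₀, ?_, ?_, ?_, ?_⟩
  · rw [u11.2 _ (by simp), u10.2 _ (by simp), u9.2 _ (by simp), u8.2 _ (by simp)]
    exact hcap7
  · rw [u11.1 _ (by simp), s11]
  · rw [u11.1 _ (by simp), s12]
  · rw [u11.1 _ (by simp), s13]
  · rw [s24]
    ring

theorem runs_solveScaled {A : Program} {w k : ℕ} {T : ℕ → ℕ → ℕ → ℕ → ℕ} (hA : SolvesMCF A w T)
    (hk : A.writeBound ≤ k + 6) {N : BudgetNetwork} {C C₀ U G Y W : ℕ}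
    (h : Setting N C₀ U G Y W) (hC : C₀ ≤ C) (hU : 1 ≤ U)
    (hY : Y = (N.m + N.n + (2 * N.n * C) ^ 4 + U + 2) ^ w) {σ : State} (hσ : SavedIn N k σ)
    (hD : σ.reg (k + 11) = ((2 * N.n * C₀ : ℕ) : ℤ) ^ 2) {j : ℤ} (hj : σ.reg (k + 22) = j)
    (hj0 : 0 ≤ j) (hj1 : j ≤ ((2 * N.n * C₀ : ℕ) : ℤ) ^ 3) :
    Runs W (solveScaled A k) σ (T N.m N.n ((2 * N.n * C) ^ 4) U + 36 * N.m + 30) (fun σ' =>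
      (∀ r, k + 6 ≤ r → r ∉ [k + 18, k + 19, k + 20, k + 21, k + 23] → σ'.reg r = σ.reg r) ∧
      (∀ a, k + 6 ≤ a → σ'.arr a = σ.arr a) ∧
      IsSolution N (((2 * N.n * C₀ : ℕ) : ℤ) ^ 2) j Y (σ'.arr 5) (σ'.reg 5)
        (σ'.reg (k + 23))) := by
  have hGW := h.G_le_W
  have hnG := h.n_le
  have hmG := h.m_le
  have hG := h.two_le_G
  have hmW : N.m ≤ W := by omega
  have hW : 1 ≤ W := by omega
  have hpowW : ((2 * N.n * C₀ : ℕ) : ℤ) ^ 4 ≤ W := by exact_mod_cast h.pow_le_W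
  have hn1 := Setting.one_le_n N
  have hscaled := h.scaled_bounds hj0 hj1
  have hDpos : (0 : ℤ) < ((2 * N.n * C₀ : ℕ) : ℤ) ^ 2 := by
    have := h.two_le
    have := h.one_le_C₀
    have : 0 < 2 * N.n * C₀ := by omega
    positivity
  have hfeeG : ∀ e, N.fee e ≤ G := fun e => (h.fee_le e).trans h.C₀_le
  have hcapG : ∀ e, N.cap e ≤ G := fun e => (h.cap_le e).trans h.U_le
  generalize hDdef : ((2 * N.n * C₀ : ℕ) : ℤ) ^ 2 = D at *
  -- the input of `A`
  refine runs_block_wp 9 (fun σ' => Unchanged [0, 1, 2, 3, 5] [] σ σ' ∧ σ'.reg 0 = N.n ∧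
    σ'.reg 1 = N.m ∧ σ'.reg 2 = (N.s : ℕ) ∧ σ'.reg 3 = (N.t : ℕ) ∧ σ'.reg 5 = 0) rfl (by omega)
    ?_ ?_
  · have b2 := N.s.2
    have b3 := N.t.2
    simp [block, wp, wp_mov, hσ.n, hσ.m, hσ.s, hσ.t]
    refine ⟨by omega, by omega, by omega, by omega, ?_⟩
    refine Unchanged.setReg ?_ (by simp) _
    refine Unchanged.setReg (Unchanged.setReg ?_ (by simp) _) (by simp) _
    refine Unchanged.setReg (Unchanged.setReg ?_ (by simp) _) (by simp) _
    exact Unchanged.refl _ _ _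
  rintro σ₁ ⟨u1, r0, r1, r2, r3, r5⟩
  have hσ1 : SavedIn N k σ₁ := hσ.unchanged u1 (by simp) (by simp)
  refine runs_block_cons (runs_copyLoop hmW hW hσ1.m (by omega)
    (forall_abs_le_of_fin hσ1.tail (fun e => abs_natCast_le (by
      have := (N.tail e).2; omega)))) (by omega) ?_
  rintro σ₂ ⟨u2, c2⟩
  have hσ2 : SavedIn N k σ₂ := hσ1.unchanged u2 (by simp) (by simp)
  refine runs_block_cons (runs_copyLoop hmW hW hσ2.m (by omega)
    (forall_abs_le_of_fin hσ2.head (fun e => abs_natCast_le (by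
      have := (N.head e).2; omega)))) (by omega) ?_
  rintro σ₃ ⟨u3, c3⟩
  have hσ3 : SavedIn N k σ₃ := hσ2.unchanged u3 (by simp) (by simp)
  refine runs_block_cons (runs_copyLoop hmW hW hσ3.m (by omega)
    (forall_abs_le_of_fin hσ3.cap (fun e => abs_natCast_le (by
      have := hcapG e; omega)))) (by omega) ?_
  rintro σ₄ ⟨u4, c4⟩
  have hσ4 : SavedIn N k σ₄ := hσ3.unchanged u4 (by simp) (by simp)
  have hreg4 : ∀ r, r ∉ [0, 1, 2, 3, 5, k + 18, k + 19, k + 20, k + 21] →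
      σ₄.reg r = σ.reg r := by
    intro r hr
    simp only [List.mem_cons, List.not_mem_nil, not_or] at hr
    rw [u4.1 _ (by simp; omega), u3.1 _ (by simp; omega), u2.1 _ (by simp; omega),
      u1.1 _ (by simp; omega)]
  refine runs_block_cons (runs_costLoop (D := D) (j := j) hmW hW hσ4.m
    (by rw [hreg4 _ (by simp), hD])
    (by rw [hreg4 _ (by simp), hj]) (fun e he => ?_)) (by omega) ?_
  · have h9 : σ₄.arr (k + 9) (e : ℕ) = N.cost ⟨e, he⟩ := hσ4.cost ⟨e, he⟩
    have h10 : σ₄.arr (k + 10) (e : ℕ) = N.fee ⟨e, he⟩ := hσ4.fee ⟨e, he⟩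
    obtain ⟨b1, b2, b3⟩ := hscaled ⟨e, he⟩
    have b4 := h.cost_le ⟨e, he⟩
    have b5 := hfeeG ⟨e, he⟩
    have b6 := h.C₀_le
    rw [h9, h10]
    exact ⟨by omega, b1.trans hpowW, abs_natCast_le (by omega), b2.trans hpowW, b3.trans hpowW⟩
  rintro σ₅ ⟨u5, c5⟩
  have hσ5 : SavedIn N k σ₅ := hσ4.unchanged u5 (by simp) (by simp)
  have hstored : (N.scaled D j).StoredIn σ₅ := by
    refine ⟨?_, ?_, ?_, ?_, fun e => ⟨?_, ?_, ?_, ?_⟩⟩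
    · rw [u5.1 _ (by simp), u4.1 _ (by simp), u3.1 _ (by simp), u2.1 _ (by simp), r0]
      rfl
    · rw [u5.1 _ (by simp), u4.1 _ (by simp), u3.1 _ (by simp), u2.1 _ (by simp), r1]
      rfl
    · rw [u5.1 _ (by simp), u4.1 _ (by simp), u3.1 _ (by simp), u2.1 _ (by simp), r2]
      rfl
    · rw [u5.1 _ (by simp), u4.1 _ (by simp), u3.1 _ (by simp), u2.1 _ (by simp), r3]
      rfl
    · rw [u5.2 _ (by simp), u4.2 _ (by simp), u3.2 _ (by simp)]
      exact forall_fin_of_copy c2 hσ1.tail e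
    · rw [u5.2 _ (by simp), u4.2 _ (by simp)]
      exact forall_fin_of_copy c3 hσ2.head e
    · rw [u5.2 _ (by simp)]
      exact forall_fin_of_copy c4 hσ3.cap e
    · have h9 := hσ4.cost e
      have h10 := hσ4.fee e
      have := c5 e e.2
      rw [h9, h10] at this
      exact this
  -- the call of `A`
  have hCpos : 1 ≤ (2 * N.n * C) ^ 4 := by
    have := h.one_le_C₀
    have : 0 < 2 * N.n * C := by
      have : 1 ≤ C := by omega
      positivity
    exact Nat.one_le_pow _ _ this
  have hcost' : ∀ e, |(N.scaled D j).cost e| ≤ (((2 * N.n * C) ^ 4 : ℕ) : ℤ) := by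
    intro e
    refine (hscaled e).2.2.trans ?_
    have : (2 * N.n * C₀) ^ 4 ≤ (2 * N.n * C) ^ 4 :=
      Nat.pow_le_pow_left (Nat.mul_le_mul_left _ hC) 4
    exact_mod_cast this
  obtain ⟨σ₆, τ, x, hex, hτ, ⟨hpos, hout⟩, hx⟩ :=
    hA (N.scaled D j) _ U hCpos hU hcost' h.cap_le σ₅ hstored
  have hexY : Exec Y A σ₅ σ₆ τ := by
    rw [hY]
    exact hex
  have hYW : Y ≤ W := by
    have := h.pow_mul_le_W (i := 0) (j := 1) (by omega) (by omega)
    simp only [pow_zero, one_mul, pow_one] at this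
    exact_mod_cast this
  refine runs_block_cons (Q := fun σ' => σ₆ = σ') (t := T N.m N.n ((2 * N.n * C) ^ 4) U)
    ⟨σ₆, τ, hexY.mono hYW, hτ, rfl⟩ (by omega) ?_
  rintro _ rfl
  have hframe := hexY.frame
  have hd : σ₆.reg 5 ≤ Y := by
    rcases hexY.reg_eq_or_abs_le 5 with h5 | h5
    · rw [u5.1 _ (by simp), u4.1 _ (by simp), u3.1 _ (by simp), u2.1 _ (by simp), r5] at h5
      omega
    · exact (le_abs_self _).trans h5
  have hxe : x = fun e : Fin N.m => (σ₆.arr 5 (e : ℕ) : ℝ) / σ₆.reg 5 := funext hout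
  have hopt : N.IsLagrangeOptimal ((j : ℝ) / D) x :=
    BudgetNetwork.isLagrangeOptimal_of_scaled hDpos hx
  rw [hxe] at hopt
  have hσ6 : SavedIn N k σ₆ := hσ5.of_eq (fun r hr _ => hframe.1 r (by omega))
    (fun a ha _ => hframe.2 a (by omega))
  -- the fee
  refine runs_block_wp 1 (fun σ' => Unchanged [k + 23] [] σ₆ σ' ∧ σ'.reg (k + 23) = 0) rfl
    (by omega) ⟨by simp, (Unchanged.refl _ _ _).setReg (by simp) _, by simp⟩ ?_
  rintro σ₇ ⟨u7, r23⟩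
  have hσ7 : SavedIn N k σ₇ := hσ6.unchanged u7 (by simp) (by simp)
  have h5 : σ₇.arr 5 = σ₆.arr 5 := u7.2 _ (by simp)
  have hnum := num_bounds_of_isFlow hpos hd hcapG hopt.1
  have hGY : ∀ i ≤ 5, (G : ℤ) ^ i * Y ≤ W := fun i hi => by
    simpa using h.pow_mul_le_W (i := i) (j := 1) hi (by omega)
  refine runs_block_cons (runs_sumLoop hmW hW hσ7.m r23 (fun e he => ?_) (fun i hi => ?_))
    (by omega) ?_
  · have h10 : σ₇.arr (k + 10) (e : ℕ) = N.fee ⟨e, he⟩ := hσ7.fee ⟨e, he⟩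
    obtain ⟨b1, b2⟩ : 0 ≤ σ₆.arr 5 (e : ℕ) ∧ σ₆.arr 5 (e : ℕ) ≤ G * Y := hnum ⟨e, he⟩
    have b3 := hfeeG ⟨e, he⟩
    have b4 : (N.fee ⟨e, he⟩ : ℤ) * σ₆.arr 5 (e : ℕ) ≤ G * (G * Y) :=
      mul_le_mul (by exact_mod_cast b3) b2 b1 (Nat.cast_nonneg _)
    have b5 := hGY 1 (by omega)
    have b6 := hGY 2 (by omega)
    rw [h10, h5]
    refine ⟨abs_natCast_le (by omega), ?_, ?_⟩
    · rw [abs_of_nonneg b1]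
      linarith
    · rw [abs_of_nonneg (mul_nonneg (Nat.cast_nonneg _) b1)]
      nlinarith
  · have b7 := sum_fee_bounds hfeeG hnum (Finset.univ.filter (fun e : Fin N.m => (e : ℕ) < i)) hmG
    have b8 : ∑ e ∈ Finset.range i, σ₇.arr (k + 10) e * σ₇.arr 5 e
        = ∑ e ∈ Finset.univ.filter (fun e : Fin N.m => (e : ℕ) < i),
          (N.fee e : ℤ) * σ₆.arr 5 (e : ℕ) := by
      rw [Finset.sum_filter, h5]
      have : ∀ e : Fin N.m, (if (e : ℕ) < i then (N.fee e : ℤ) * σ₆.arr 5 (e : ℕ) else 0)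
          = (fun e : ℕ => if e < i then σ₇.arr (k + 10) e * σ₆.arr 5 e else 0) e := fun e => by
        simp only [hσ7.fee e]
      rw [Finset.sum_congr rfl (fun e _ => this e), ← Finset.sum_range
        (fun e : ℕ => if e < i then σ₇.arr (k + 10) e * σ₆.arr 5 e else 0), ← Finset.sum_filter]
      refine Finset.sum_congr ?_ (fun _ _ => rfl)
      ext e
      simp
      omega
    rw [b8, abs_of_nonneg b7.1]
    exact b7.2.trans (hGY 3 (by omega))
  rintro σ₈ ⟨u8, hsum⟩
  have h58 : σ₈.arr 5 = σ₆.arr 5 := by rw [u8.2 _ (by simp), h5]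
  have h5r : σ₈.reg 5 = σ₆.reg 5 := by rw [u8.1 _ (by simp), u7.1 _ (by simp)]
  refine runs_block_nil ⟨fun r hr hr' => ?_, fun a ha => ?_, ?_⟩
  · simp only [List.mem_cons, List.not_mem_nil, not_or] at hr'
    rw [u8.1 _ (by simp; omega), u7.1 _ (by simp; omega), hframe.1 _ (by omega),
      u5.1 _ (by simp; omega), hreg4 _ (by simp; omega)]
  · rw [u8.2 _ (by simp), u7.2 _ (by simp), hframe.2 _ (by omega), u5.2 _ (by simp; omega),
      u4.2 _ (by simp; omega), u3.2 _ (by simp; omega), u2.2 _ (by simp; omega),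
      u1.2 _ (by simp)]
  · rw [h58, h5r]
    refine ⟨hpos, hd, hopt, ?_⟩
    rw [hsum, Finset.sum_range, h5]
    exact Finset.sum_congr rfl (fun e _ => by rw [hσ7.fee e])

/-! ### The binary search -/

theorem runs_record {W k x d f a M : ℕ} {σ : State} (hM : M ≤ W) (hW : 1 ≤ W)
    (hm : σ.reg (k + 7) = M) (ha : 5 ≠ a) (h22 : k + 22 ≠ x) (h5x : 5 ≠ x) (h5d : 5 ≠ d)
    (h23x : k + 23 ≠ x) (h23d : k + 23 ≠ d) (h23f : k + 23 ≠ f) (hxd : x ≠ d) (hxf : x ≠ f)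
    (hdf : d ≠ f) (hb : ∀ e : ℕ, e < M → |σ.arr 5 e| ≤ (W : ℤ)) (hb1 : |σ.reg (k + 22)| ≤ (W : ℤ))
    (hb2 : |σ.reg 5| ≤ (W : ℤ)) (hb3 : |σ.reg (k + 23)| ≤ (W : ℤ)) :
    Runs W (record k x d f a) σ (6 * M + 9) (fun σ' =>
      Unchanged [x, d, f, k + 18, k + 19, k + 20, k + 21] [a] σ σ' ∧
      (∀ e : ℕ, e < M → σ'.arr a e = σ.arr 5 e) ∧ σ'.reg x = σ.reg (k + 22) ∧
      σ'.reg d = σ.reg 5 ∧ σ'.reg f = σ.reg (k + 23)) := by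
  refine runs_block_cons (runs_copyLoop hM hW hm ha hb) (by omega) ?_
  rintro σ₁ ⟨u1, c1⟩
  have e1 : σ₁.reg (k + 22) = σ.reg (k + 22) := u1.1 _ (by simp)
  have e2 : σ₁.reg 5 = σ.reg 5 := u1.1 _ (by simp)
  have e3 : σ₁.reg (k + 23) = σ.reg (k + 23) := u1.1 _ (by simp)
  refine runs_block_wp 6 (fun σ' => Unchanged [x, d, f, k + 18, k + 19, k + 20, k + 21] [a] σ₁ σ' ∧
    σ'.arr = σ₁.arr ∧ σ'.reg x = σ.reg (k + 22) ∧
      σ'.reg d = σ.reg 5 ∧ σ'.reg f = σ.reg (k + 23)) rfl (by omega) ?_ ?_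
  · rw [block, block, block, block]
    simp only [wp]
    rw [wp_mov h22, wp_mov h5d, wp_mov h23f]
    simp only [State.reg_setReg, if_neg h5x, if_neg h23d, if_neg h23x, e1, e2, e3, if_neg hxd,
      if_neg hxf, if_neg hdf, if_true]
    refine ⟨hb1, hb2, hb3, ?_, rfl, trivial, trivial, trivial⟩
    refine Unchanged.setReg (Unchanged.setReg ?_ (by simp) _) (by simp) _
    exact (Unchanged.refl _ _ _).setReg (by simp) _
  rintro σ₂ ⟨u2, h2, h3, h4, h5⟩
  refine runs_block_nil ⟨(u1.mono (by simp) (by simp)).trans u2, ?_, h3, h4, h5⟩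
  rw [h2]
  exact c1

/-- The invariant of the binary search. The registers `k + 12` and `k + 13` hold the ends of the
interval; the solutions for its ends are known, except for the initial ends `-1` and `N₀ ^ 3 + 1`,
for which none are computed. The fee of the left one exceeds the budget, the fee of the right one
does not. At most `h` rounds remain. -/
structure SearchState (N : BudgetNetwork) (k C₀ U Y h : ℕ) (σ : State) : Prop where
  saved : SavedIn N k σ
  den : σ.reg (k + 11) = ((2 * N.n * C₀ : ℕ) : ℤ) ^ 2
  left_ge : -1 ≤ σ.reg (k + 12)
  left_lt : σ.reg (k + 12) < σ.reg (k + 13)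
  right_le : σ.reg (k + 13) ≤ ((2 * N.n * C₀ : ℕ) : ℤ) ^ 3 + 1
  gap : σ.reg (k + 13) - σ.reg (k + 12) ≤ 2 ^ h
  guard : σ.reg (k + 24) = σ.reg (k + 13) - σ.reg (k + 12) - 1
  left : 0 ≤ σ.reg (k + 12) → IsSolution N (((2 * N.n * C₀ : ℕ) : ℤ) ^ 2) (σ.reg (k + 12)) Y
    (σ.arr (k + 11)) (σ.reg (k + 14)) (σ.reg (k + 15)) ∧
    N.budget * σ.reg (k + 14) < σ.reg (k + 15)
  right : σ.reg (k + 13) ≤ ((2 * N.n * C₀ : ℕ) : ℤ) ^ 3 →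
    IsSolution N (((2 * N.n * C₀ : ℕ) : ℤ) ^ 2) (σ.reg (k + 13)) Y
    (σ.arr (k + 12)) (σ.reg (k + 16)) (σ.reg (k + 17)) ∧
    σ.reg (k + 17) ≤ N.budget * σ.reg (k + 16)
  init : σ.reg (k + 12) < 0 → ∀ e : Fin N.m, |σ.arr (k + 11) (e : ℕ)| ≤ (U : ℤ)

theorem runs_searchStep {A : Program} {w k : ℕ} {T : ℕ → ℕ → ℕ → ℕ → ℕ} (hA : SolvesMCF A w T)
    (hk : A.writeBound ≤ k + 6) {N : BudgetNetwork} {C C₀ U G Y W : ℕ}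
    (hS : Setting N C₀ U G Y W) (hC : C₀ ≤ C) (hU : 1 ≤ U)
    (hY : Y = (N.m + N.n + (2 * N.n * C) ^ 4 + U + 2) ^ w) {σ : State} {h : ℕ}
    (hσ : SearchState N k C₀ U Y h σ) (hpos : 0 < σ.reg (k + 24)) :
    ∃ h', h = h' + 1 ∧ Runs W (searchStep A k) σ
      (T N.m N.n ((2 * N.n * C) ^ 4) U + 42 * N.m + 48) (SearchState N k C₀ U Y h') := by
  obtain ⟨saved, den, lge, llt, rle, gap, guard, left, right, init⟩ := hσ
  obtain ⟨h', rfl⟩ : ∃ h', h = h' + 1 := by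
    refine ⟨h - 1, ?_⟩
    rcases Nat.eq_zero_or_pos h with rfl | h0
    · simp at gap
      omega
    · omega
  refine ⟨h', rfl, ?_⟩
  have hmW : N.m ≤ W := by
    have := hS.m_le
    have := hS.G_le_W
    omega
  have hW : 1 ≤ W := by
    have := hS.two_le_G
    have := hS.G_le_W
    omega
  have hpowW : ((2 * N.n * C₀ : ℕ) : ℤ) ^ 4 ≤ W := by exact_mod_cast hS.pow_le_W
  have hN₀2 : (2 : ℤ) ≤ ((2 * N.n * C₀ : ℕ) : ℤ) := by
    have := hS.two_le
    have := hS.one_le_C₀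
    omega
  obtain ⟨p2, p3, p4⟩ := pow_chain hN₀2
  obtain ⟨N₃, hN₃⟩ : ∃ N₃ : ℤ, N₃ = ((2 * N.n * C₀ : ℕ) : ℤ) ^ 3 := ⟨_, rfl⟩
  rw [pow_succ] at gap
  rw [← hN₃] at rle right p3 p4
  -- the middle
  have hmid : ∃ j, j = (σ.reg (k + 12) + σ.reg (k + 13)) / 2 := ⟨_, rfl⟩
  obtain ⟨j, hj⟩ := hmid
  refine runs_block_wp 3 (fun σ' => Unchanged [k + 20, k + 22] [] σ σ' ∧ σ'.reg (k + 22) = j) rfl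
    (by omega) ?_ ?_
  · simp [block, wp, Op.eval, ← hj]
    refine ⟨by rw [abs_le]; omega, by omega, by rw [abs_le]; omega, ?_⟩
    refine Unchanged.setReg (Unchanged.setReg ?_ (by simp) _) (by simp) _
    exact (Unchanged.refl _ _ _).setReg (by simp) _
  rintro σ₁ ⟨u1, r22⟩
  have saved1 := saved.unchanged u1 (by simp) (by simp)
  have den1 : σ₁.reg (k + 11) = ((2 * N.n * C₀ : ℕ) : ℤ) ^ 2 := by rw [u1.1 _ (by simp), den]
  refine runs_block_cons (runs_solveScaled hA hk hS hC hU hY saved1 den1 r22 (by omega)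
    (by rw [← hN₃]; omega)) (by omega) ?_
  rintro σ₂ ⟨hr2, ha2, hsol⟩
  have hr2' : ∀ r, k + 6 ≤ r → r ∉ [k + 18, k + 19, k + 20, k + 21, k + 22, k + 23] →
      σ₂.reg r = σ.reg r := by
    intro r h1 h2
    simp only [List.mem_cons, List.not_mem_nil, not_or] at h2
    rw [hr2 r h1 (by simp; omega), u1.1 _ (by simp; omega)]
  have ha2' : ∀ a, k + 6 ≤ a → σ₂.arr a = σ.arr a := fun a h1 => by
    rw [ha2 a h1, u1.2 _ (by simp)]
  have r22' : σ₂.reg (k + 22) = j := by rw [hr2 _ (by omega) (by simp), r22]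
  have saved2 : SavedIn N k σ₂ := saved.of_eq
    (fun r h1 h2 => hr2' r h1 (by simp; omega)) (fun a h1 _ => ha2' a h1)
  have hcapG : ∀ e, N.cap e ≤ G := fun e => (hS.cap_le e).trans hS.U_le
  have hfeeG : ∀ e, N.fee e ≤ G := fun e => (hS.fee_le e).trans hS.C₀_le
  have hfb := hsol.fee_bounds hcapG hfeeG hS.m_le
  have hnum := hsol.num_bounds hcapG
  have hd0 := hsol.pos
  have hdY := hsol.le
  have hGY : ∀ i ≤ 5, (G : ℤ) ^ i * Y ≤ W := fun i hi => by
    simpa using hS.pow_mul_le_W (i := i) (j := 1) hi (by omega)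
  have q0 := hGY 0 (by omega)
  have q1 := hGY 1 (by omega)
  have q3 := hGY 3 (by omega)
  simp only [pow_zero, one_mul, pow_one] at q0 q1
  have hBd : (N.budget : ℤ) * σ₂.reg 5 ≤ G * Y :=
    mul_le_mul (by exact_mod_cast hS.budget_le) hdY hd0.le (Nat.cast_nonneg _)
  have hBd0 : 0 ≤ (N.budget : ℤ) * σ₂.reg 5 := mul_nonneg (Nat.cast_nonneg _) hd0.le
  -- the comparison of the fee with the budget
  refine runs_block_wp 2 (fun σ' => Unchanged [k + 20] [] σ₂ σ' ∧
    σ'.reg (k + 20) = σ₂.reg (k + 23) - N.budget * σ₂.reg 5) rfl (by omega) ?_ ?_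
  · simp [block, wp, Op.eval, saved2.budget, -abs_mul]
    refine ⟨by rw [abs_le]; omega, by rw [abs_le]; omega, ?_⟩
    refine Unchanged.setReg (Unchanged.setReg ?_ (by simp) _) (by simp) _
    exact Unchanged.refl _ _ _
  rintro σ₃ ⟨u3, r20⟩
  have saved3 := saved2.unchanged u3 (by simp) (by simp)
  have hr3 : ∀ r, k + 6 ≤ r → r ∉ [k + 18, k + 19, k + 20, k + 21, k + 22, k + 23] →
      σ₃.reg r = σ.reg r := by
    intro r h1 h2
    rw [u3.1 r (by simp at h2 ⊢; omega), hr2' r h1 h2]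
  have ha3 : ∀ a, k + 6 ≤ a → σ₃.arr a = σ.arr a := fun a h1 => by
    rw [u3.2 _ (by simp), ha2' a h1]
  have r22₃ : σ₃.reg (k + 22) = j := by rw [u3.1 _ (by simp), r22']
  have hsol3 : IsSolution N (((2 * N.n * C₀ : ℕ) : ℤ) ^ 2) j Y (σ₃.arr 5) (σ₃.reg 5)
      (σ₃.reg (k + 23)) := by
    rw [u3.1 _ (by simp), u3.1 _ (by simp), u3.2 _ (by simp)]
    exact hsol
  have hb : ∀ e : ℕ, e < N.m → |σ₃.arr 5 e| ≤ (W : ℤ) := fun e he => by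
    rw [u3.2 _ (by simp)]
    have := hnum ⟨e, he⟩
    simp only at this
    rw [abs_le]
    omega
  have hb1 : |σ₃.reg (k + 22)| ≤ (W : ℤ) := by rw [r22₃, abs_le]; omega
  have hb2 : |σ₃.reg 5| ≤ (W : ℤ) := by rw [u3.1 _ (by simp), abs_le]; omega
  have hb3 : |σ₃.reg (k + 23)| ≤ (W : ℤ) := by rw [u3.1 _ (by simp), abs_le]; omega
  have e5 : σ₂.reg 5 = σ₃.reg 5 := (u3.1 _ (by simp)).symm
  have e23 : σ₂.reg (k + 23) = σ₃.reg (k + 23) := (u3.1 _ (by simp)).symm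
  rw [e5, e23] at r20
  -- the half that is kept
  refine runs_block_cons (t := 6 * N.m + 9 + 1) (Q := fun σ' => SavedIn N k σ' ∧
    σ'.reg (k + 11) = ((2 * N.n * C₀ : ℕ) : ℤ) ^ 2 ∧ -1 ≤ σ'.reg (k + 12) ∧
    σ'.reg (k + 12) < σ'.reg (k + 13) ∧ σ'.reg (k + 13) ≤ N₃ + 1 ∧
    σ'.reg (k + 13) - σ'.reg (k + 12) ≤ 2 ^ h' ∧
    (0 ≤ σ'.reg (k + 12) → IsSolution N (((2 * N.n * C₀ : ℕ) : ℤ) ^ 2) (σ'.reg (k + 12)) Y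
      (σ'.arr (k + 11)) (σ'.reg (k + 14)) (σ'.reg (k + 15)) ∧
      N.budget * σ'.reg (k + 14) < σ'.reg (k + 15)) ∧
    (σ'.reg (k + 13) ≤ N₃ →
      IsSolution N (((2 * N.n * C₀ : ℕ) : ℤ) ^ 2) (σ'.reg (k + 13)) Y
      (σ'.arr (k + 12)) (σ'.reg (k + 16)) (σ'.reg (k + 17)) ∧
      σ'.reg (k + 17) ≤ N.budget * σ'.reg (k + 16)) ∧
    (σ'.reg (k + 12) < 0 → ∀ e : Fin N.m, |σ'.arr (k + 11) (e : ℕ)| ≤ (U : ℤ)))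
    (runs_cond (fun hgt => ?_) (fun hle => ?_)) (by omega) ?_
  · refine (runs_record hmW hW saved3.m (by omega) (by simp) (by omega) (by omega) (by simp)
      (by simp) (by simp) (by simp) (by simp) (by simp) hb hb1 hb2 hb3).mono le_rfl ?_
    rintro σ₄ ⟨u4, c4, g1, g2, g3⟩
    have i13 : σ₄.reg (k + 13) = σ.reg (k + 13) := by
      rw [u4.1 _ (by simp), hr3 _ (by omega) (by simp)]
    rw [g1, g2, g3, r22₃, i13]
    refine ⟨saved3.unchanged u4 (by simp) (by simp), ?_, by omega, by omega, by omega, by omega,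
      fun _ => ⟨hsol3.congr c4, by omega⟩, fun h13 => ?_, fun hneg => absurd hneg (by omega)⟩
    · rw [u4.1 _ (by simp), hr3 _ (by omega) (by simp), den]
    · have := right h13
      rwa [u4.1 (k + 16) (by simp), u4.1 (k + 17) (by simp), u4.2 (k + 12) (by simp),
        hr3 (k + 16) (by omega) (by simp), hr3 (k + 17) (by omega) (by simp), ha3 _ (by omega)]
  · refine (runs_record hmW hW saved3.m (by omega) (by simp) (by omega) (by omega) (by simp)
      (by simp) (by simp) (by simp) (by simp) (by simp) hb hb1 hb2 hb3).mono le_rfl ?_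
    rintro σ₄ ⟨u4, c4, g1, g2, g3⟩
    have i12 : σ₄.reg (k + 12) = σ.reg (k + 12) := by
      rw [u4.1 _ (by simp), hr3 _ (by omega) (by simp)]
    rw [g1, g2, g3, r22₃, i12]
    refine ⟨saved3.unchanged u4 (by simp) (by simp), ?_, by omega, by omega, by omega, by omega,
      fun h12 => ?_, fun _ => ⟨hsol3.congr c4, by omega⟩, fun hneg => ?_⟩
    · rw [u4.1 _ (by simp), hr3 _ (by omega) (by simp), den]
    · have := left h12
      rwa [u4.1 (k + 14) (by simp), u4.1 (k + 15) (by simp), u4.2 (k + 11) (by simp),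
        hr3 (k + 14) (by omega) (by simp), hr3 (k + 15) (by omega) (by simp), ha3 _ (by omega)]
    · rw [u4.2 (k + 11) (by simp), ha3 _ (by omega)]
      exact init hneg
  rintro σ₄ ⟨saved4, den4, lge4, llt4, rle4, gap4, left4, right4, init4⟩
  refine runs_block_cons (runs_setGuard hW (by rw [abs_le]; omega) (by rw [abs_le]; omega))
    (by omega) ?_
  rintro σ₅ ⟨u5, r24⟩
  have e11 : σ₅.reg (k + 11) = σ₄.reg (k + 11) := u5.1 _ (by simp)
  have e12 : σ₅.reg (k + 12) = σ₄.reg (k + 12) := u5.1 _ (by simp)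
  have e13 : σ₅.reg (k + 13) = σ₄.reg (k + 13) := u5.1 _ (by simp)
  have e14 : σ₅.reg (k + 14) = σ₄.reg (k + 14) := u5.1 _ (by simp)
  have e15 : σ₅.reg (k + 15) = σ₄.reg (k + 15) := u5.1 _ (by simp)
  have e16 : σ₅.reg (k + 16) = σ₄.reg (k + 16) := u5.1 _ (by simp)
  have e17 : σ₅.reg (k + 17) = σ₄.reg (k + 17) := u5.1 _ (by simp)
  have a11 : σ₅.arr (k + 11) = σ₄.arr (k + 11) := u5.2 _ (by simp)
  have a12 : σ₅.arr (k + 12) = σ₄.arr (k + 12) := u5.2 _ (by simp)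
  subst hN₃
  refine runs_block_nil ⟨saved4.unchanged u5 (by simp) (by simp), ?_, ?_, ?_, ?_, ?_, ?_, ?_, ?_,
    ?_⟩
  · rw [e11, den4]
  · rwa [e12]
  · rwa [e12, e13]
  · rwa [e13]
  · rwa [e12, e13]
  · rw [r24, e12, e13]
  · rwa [e12, e14, e15, a11]
  · rwa [e13, e16, e17, a12]
  · rwa [e12, a11]

theorem IsSolution.isOptimal_combination {N : BudgetNetwork} {C₀ Y : ℕ} {l d₁ d₂ β₁ β₂ : ℤ}
    {a₁ a₂ : ℤ → ℤ} (hC₀ : 1 ≤ C₀) (hcost : ∀ e, |N.cost e| ≤ (C₀ : ℤ)) (hfee : ∀ e, N.fee e ≤ C₀)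
    (hl : 0 ≤ l) (h₁ : IsSolution N (((2 * N.n * C₀ : ℕ) : ℤ) ^ 2) l Y a₁ d₁ β₁)
    (h₂ : IsSolution N (((2 * N.n * C₀ : ℕ) : ℤ) ^ 2) (l + 1) Y a₂ d₂ β₂)
    (hB₁ : N.budget * d₁ < β₁) (hB₂ : β₂ ≤ N.budget * d₂) :
    N.IsOptimal (fun e => (((N.budget * d₂ - β₂) * a₁ (e : ℕ) + (β₁ - N.budget * d₁) * a₂ (e : ℕ) :
      ℤ) : ℝ) / ((β₁ * d₂ - β₂ * d₁ : ℤ) : ℝ)) := by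
  have hd₁ : (0 : ℝ) < d₁ := by exact_mod_cast h₁.pos
  have hd₂ : (0 : ℝ) < d₂ := by exact_mod_cast h₂.pos
  have hK : (0 : ℝ) < ((N.n * C₀ : ℕ) : ℝ) := by
    have := Setting.one_le_n N
    have : 0 < N.n * C₀ := by positivity
    exact_mod_cast this
  have hlr : (0 : ℝ) ≤ l := by exact_mod_cast hl
  have hD : ((((2 * N.n * C₀ : ℕ) : ℤ) ^ 2 : ℤ) : ℝ) = 4 * ((N.n * C₀ : ℕ) : ℝ) ^ 2 := by
    push_cast
    ring
  have o₁ := h₁.opt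
  have o₂ := h₂.opt
  have f₁ := h₁.totalFee_eq
  have f₂ := h₂.totalFee_eq
  rw [hD] at o₁ o₂
  have hB₁' : (N.budget : ℝ) * d₁ < β₁ := by exact_mod_cast hB₁
  have hB₂' : (β₂ : ℝ) ≤ N.budget * d₂ := by exact_mod_cast hB₂
  have key := BudgetNetwork.isOptimal_combination hcost hfee (div_nonneg hlr (by positivity))
    (div_le_div_of_nonneg_right (by push_cast; linarith) (by positivity)) (by
      have h1 : ((l + 1 : ℤ) : ℝ) - l = 1 := by
        push_cast
        ring
      have h2 := pow_pos hK 2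
      rw [← sub_div, h1, div_mul_eq_mul_div, div_lt_one (by positivity)]
      linarith) o₁ o₂ (by rw [f₁, lt_div_iff₀ hd₁]; exact hB₁')
    (by rw [f₂, div_le_iff₀ hd₂]; exact hB₂')
  have hden : (0 : ℝ) < β₁ * d₂ - β₂ * d₁ := by nlinarith
  have heq : ∀ e : Fin N.m, (((N.budget * d₂ - β₂) * a₁ (e : ℕ) + (β₁ - N.budget * d₁) *
      a₂ (e : ℕ) : ℤ) : ℝ) / ((β₁ * d₂ - β₂ * d₁ : ℤ) : ℝ) =
      ((N.budget - (β₂ : ℝ) / d₂) * ((a₁ (e : ℕ) : ℝ) / d₁) +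
        ((β₁ : ℝ) / d₁ - N.budget) * ((a₂ (e : ℕ) : ℝ) / d₂)) / ((β₁ : ℝ) / d₁ - (β₂ : ℝ) / d₂) := by
    intro e
    have e1 : (β₁ : ℝ) / d₁ - (β₂ : ℝ) / d₂ = (β₁ * d₂ - β₂ * d₁) / (d₁ * d₂) := by
      field_simp
    rw [e1]
    push_cast
    have hden' := hden.ne'
    field_simp
  rw [f₁, f₂] at key
  simpa only [heq] using key

theorem IsSolution.isOptimal_of_zero {N : BudgetNetwork} {D d β : ℤ} {Y : ℕ} {a : ℤ → ℤ}
    (h : IsSolution N D 0 Y a d β) (hB : β ≤ N.budget * d) :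
    N.IsOptimal (fun e => (a (e : ℕ) : ℝ) / d) := by
  have hd : (0 : ℝ) < d := by exact_mod_cast h.pos
  have ho := h.opt
  simp only [Int.cast_zero, zero_div] at ho
  refine ho.isOptimal le_rfl ?_ (by simp)
  rw [h.totalFee_eq, div_le_iff₀ hd]
  exact_mod_cast hB

/-- The largest multiplier of the grid lies above all breakpoints, so its solution has fee zero. -/
theorem IsSolution.fee_le_budget {N : BudgetNetwork} {C₀ Y : ℕ} {d β : ℤ} {a : ℤ → ℤ}
    (hC₀ : 1 ≤ C₀) (hcost : ∀ e, |N.cost e| ≤ (C₀ : ℤ)) (hfee : ∀ e, N.fee e ≤ C₀)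
    (h : IsSolution N (((2 * N.n * C₀ : ℕ) : ℤ) ^ 2) (((2 * N.n * C₀ : ℕ) : ℤ) ^ 3) Y a d β) :
    β ≤ N.budget * d := by
  have hd : (0 : ℝ) < d := by exact_mod_cast h.pos
  have hK : 0 < N.n * C₀ := by
    have := Setting.one_le_n N
    positivity
  have hKr : (0 : ℝ) < ((N.n * C₀ : ℕ) : ℝ) := by exact_mod_cast hK
  have hl : (((((2 * N.n * C₀ : ℕ) : ℤ) ^ 3 : ℤ) : ℝ) / ((((2 * N.n * C₀ : ℕ) : ℤ) ^ 2 : ℤ) : ℝ))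
      = 2 * ((N.n * C₀ : ℕ) : ℝ) := by
    have e2 : (((2 * N.n * C₀ : ℕ) : ℤ) : ℝ) = 2 * ((N.n * C₀ : ℕ) : ℝ) := by
      push_cast
      ring
    rw [Int.cast_pow, Int.cast_pow, e2]
    field_simp
  have ho := h.opt
  rw [hl] at ho
  have h0 := ho.totalFee_nonpos hcost hfee (by linarith)
  rw [h.totalFee_eq, div_le_iff₀ hd, zero_mul] at h0
  have h1 : β ≤ 0 := by exact_mod_cast h0
  exact h1.trans (mul_nonneg (Nat.cast_nonneg _) h.pos.le)

set_option maxHeartbeats 800000 in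
theorem runs_epilogue {N : BudgetNetwork} {k C₀ U G Y W h : ℕ} (hS : Setting N C₀ U G Y W)
    {σ : State} (hσ : SearchState N k C₀ U Y h σ) (hg : σ.reg (k + 24) ≤ 0) :
    Runs W (epilogue k) σ (10 * N.m + 13) (fun σ' =>
      ∃ x : Fin N.m → ℝ, Outputs σ' x ∧ N.IsOptimal x) := by
  obtain ⟨saved, den, lge, llt, rle, gap, guard, left, right, init⟩ := hσ
  have h13 : σ.reg (k + 13) = σ.reg (k + 12) + 1 := by omega
  have hright : σ.reg (k + 13) ≤ ((2 * N.n * C₀ : ℕ) : ℤ) ^ 3 := by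
    -- otherwise the left solution belongs to the largest multiplier and has fee zero
    by_contra hcon
    have hN₀ : (0 : ℤ) ≤ ((2 * N.n * C₀ : ℕ) : ℤ) ^ 3 := by positivity
    have h12 : σ.reg (k + 12) = ((2 * N.n * C₀ : ℕ) : ℤ) ^ 3 := by omega
    obtain ⟨hl, hB⟩ := left (by omega)
    rw [h12] at hl
    have := hl.fee_le_budget hS.one_le_C₀ hS.cost_le hS.fee_le
    omega
  obtain ⟨hr, hBr⟩ := right hright
  have hN₃W : ((2 * N.n * C₀ : ℕ) : ℤ) ^ 3 + 1 ≤ W := by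
    have hpowW : ((2 * N.n * C₀ : ℕ) : ℤ) ^ 4 ≤ W := by exact_mod_cast hS.pow_le_W
    have hN₀2 : (2 : ℤ) ≤ ((2 * N.n * C₀ : ℕ) : ℤ) := by
      have := hS.two_le
      have := hS.one_le_C₀
      omega
    obtain ⟨p2, p3, p4⟩ := pow_chain hN₀2
    omega
  have hmW : N.m ≤ W := by
    have := hS.m_le
    have := hS.G_le_W
    omega
  have hW : 1 ≤ W := by
    have := hS.two_le_G
    have := hS.G_le_W
    omega
  have hcapG : ∀ e, N.cap e ≤ G := fun e => (hS.cap_le e).trans hS.U_le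
  have hfeeG : ∀ e, N.fee e ≤ G := fun e => (hS.fee_le e).trans hS.C₀_le
  have hG2 : (2 : ℤ) ≤ G := by exact_mod_cast hS.two_le_G
  have hY1 : (1 : ℤ) ≤ Y := by exact_mod_cast hS.one_le_Y
  have hGU : (U : ℤ) ≤ G := by exact_mod_cast hS.U_le
  have hBG : (N.budget : ℤ) ≤ G := by exact_mod_cast hS.budget_le
  have hB0 : (0 : ℤ) ≤ N.budget := Nat.cast_nonneg _
  have w11 : (G : ℤ) * Y ≤ W := by simpa using hS.pow_mul_le_W (i := 1) (j := 1) (by omega) (by omega)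
  have w01 : (Y : ℤ) ≤ W := by simpa using hS.pow_mul_le_W (i := 0) (j := 1) (by omega) (by omega)
  have w31 := hS.pow_mul_le_W (i := 3) (j := 1) (by omega) (by omega)
  have w32 := hS.pow_mul_le_W (i := 3) (j := 2) (by omega) (by omega)
  have w52 := hS.pow_mul_le_W (i := 5) (j := 2) (by omega) (by omega)
  rw [pow_one] at w31
  have wG := hS.G_le_W
  have hnr := hr.num_bounds hcapG
  have hfr := hr.fee_bounds hcapG hfeeG hS.m_le
  have hdr0 := hr.pos
  have hdrY := hr.le
  have hBdr : (N.budget : ℤ) * σ.reg (k + 16) ≤ G * Y := mul_le_mul hBG hdrY hdr0.le (by omega)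
  have hBdr0 : 0 ≤ (N.budget : ℤ) * σ.reg (k + 16) := mul_nonneg hB0 hdr0.le
  -- if the left end is still `-1`, then the right end is the multiplier `0`
  by_cases h12 : 0 ≤ σ.reg (k + 12)
  · obtain ⟨hl, hBl⟩ := left h12
    rw [h13] at hr
    have hopt := hl.isOptimal_combination hS.one_le_C₀ hS.cost_le hS.fee_le h12 hr hBl hBr
    have hnl := hl.num_bounds hcapG
    have hfl := hl.fee_bounds hcapG hfeeG hS.m_le
    have hdl0 := hl.pos
    have hdlY := hl.le
    have hBdl : (N.budget : ℤ) * σ.reg (k + 14) ≤ G * Y := mul_le_mul hBG hdlY hdl0.le (by omega)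
    have hBdl0 : 0 ≤ (N.budget : ℤ) * σ.reg (k + 14) := mul_nonneg hB0 hdl0.le
    have m1 : σ.reg (k + 15) * σ.reg (k + 16) ≤ (G : ℤ) ^ 3 * Y ^ 2 := by
      calc _ ≤ ((G : ℤ) ^ 3 * Y) * Y := mul_le_mul hfl.2 hdrY hdr0.le (by positivity)
        _ = _ := by ring
    have m2 : σ.reg (k + 17) * σ.reg (k + 14) ≤ (G : ℤ) ^ 3 * Y ^ 2 := by
      calc _ ≤ ((G : ℤ) ^ 3 * Y) * Y := mul_le_mul hfr.2 hdlY hdl0.le (by positivity)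
        _ = _ := by ring
    have m3 : 0 ≤ σ.reg (k + 15) * σ.reg (k + 16) := mul_nonneg hfl.1 hdr0.le
    have m4 : 0 ≤ σ.reg (k + 17) * σ.reg (k + 14) := mul_nonneg hfr.1 hdl0.le
    have hden : 0 < σ.reg (k + 15) * σ.reg (k + 16) - σ.reg (k + 17) * σ.reg (k + 14) := by
      linarith [mul_lt_mul_of_pos_right hBl hdr0, mul_le_mul_of_nonneg_right hBr hdl0.le]
    refine runs_block_wp 10 (fun σ' => Unchanged [5, k + 20, k + 21, k + 25, k + 26] [] σ σ' ∧
      σ'.reg (k + 25) = N.budget * σ.reg (k + 16) - σ.reg (k + 17) ∧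
      σ'.reg (k + 26) = σ.reg (k + 15) - N.budget * σ.reg (k + 14) ∧
      σ'.reg 5 = σ.reg (k + 15) * σ.reg (k + 16) - σ.reg (k + 17) * σ.reg (k + 14)) rfl (by omega)
      ?_ ?_
    · simp [block, wp, Op.eval, saved.budget, -abs_mul]
      refine ⟨by omega, by rw [abs_le]; omega, fun _ => ?_, fun h => absurd h (by omega)⟩
      refine ⟨by rw [abs_le]; omega, by rw [abs_le]; omega, by rw [abs_le]; omega,
        by rw [abs_le]; omega, by rw [abs_le]; omega, by rw [abs_le]; omega,
        by rw [abs_le]; omega, ?_⟩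
      refine Unchanged.setReg (Unchanged.setReg ?_ (by simp) _) (by simp) _
      refine Unchanged.setReg (Unchanged.setReg ?_ (by simp) _) (by simp) _
      refine Unchanged.setReg (Unchanged.setReg ?_ (by simp) _) (by simp) _
      refine Unchanged.setReg (Unchanged.setReg ?_ (by simp) _) (by simp) _
      refine Unchanged.setReg ?_ (by simp) _
      exact Unchanged.refl _ _ _
    rintro σ₁ ⟨u1, r25, r26, r5⟩
    have a11 : σ₁.arr (k + 11) = σ.arr (k + 11) := u1.2 _ (by simp)
    have a12 : σ₁.arr (k + 12) = σ.arr (k + 12) := u1.2 _ (by simp)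
    refine runs_block_cons (runs_combineLoop hmW hW (saved.unchanged u1 (by simp) (by simp)).m r25
      r26 (fun e he => ?_)) (by omega) ?_
    · rw [a11, a12]
      obtain ⟨b1, b2⟩ : 0 ≤ σ.arr (k + 11) (e : ℕ) ∧ σ.arr (k + 11) (e : ℕ) ≤ G * Y := hnl ⟨e, he⟩
      obtain ⟨b3, b4⟩ : 0 ≤ σ.arr (k + 12) (e : ℕ) ∧ σ.arr (k + 12) (e : ℕ) ≤ G * Y := hnr ⟨e, he⟩
      have c1 : (N.budget * σ.reg (k + 16) - σ.reg (k + 17)) * σ.arr (k + 11) (e : ℕ)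
          ≤ (G : ℤ) ^ 4 * Y ^ 2 := by
        calc _ ≤ ((G : ℤ) * Y) * (G * Y) :=
              mul_le_mul (by omega) b2 b1 (by positivity)
          _ = (G : ℤ) ^ 2 * Y ^ 2 := by ring
          _ ≤ _ := mul_le_mul_of_nonneg_right (pow_le_pow_right₀ (by omega) (by omega))
            (by positivity)
      have c2 : (σ.reg (k + 15) - N.budget * σ.reg (k + 14)) * σ.arr (k + 12) (e : ℕ)
          ≤ (G : ℤ) ^ 4 * Y ^ 2 := by
        calc _ ≤ ((G : ℤ) ^ 3 * Y) * (G * Y) :=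
              mul_le_mul (by omega) b4 b3 (by positivity)
          _ = _ := by ring
      have c3 : 0 ≤ (N.budget * σ.reg (k + 16) - σ.reg (k + 17)) * σ.arr (k + 11) (e : ℕ) :=
        mul_nonneg (by omega) b1
      have c4 : 0 ≤ (σ.reg (k + 15) - N.budget * σ.reg (k + 14)) * σ.arr (k + 12) (e : ℕ) :=
        mul_nonneg (by omega) b3
      have c5 : 2 * ((G : ℤ) ^ 4 * Y ^ 2) ≤ W := by
        refine le_trans ?_ w52
        calc 2 * ((G : ℤ) ^ 4 * Y ^ 2) ≤ G * ((G : ℤ) ^ 4 * Y ^ 2) :=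
              mul_le_mul_of_nonneg_right hG2 (by positivity)
          _ = _ := by ring
      exact ⟨by rw [abs_le]; omega, by rw [abs_le]; omega, by rw [abs_le]; omega,
        by rw [abs_le]; omega, by rw [abs_le]; omega⟩
    rintro σ₂ ⟨u2, c2⟩
    refine runs_block_nil ⟨_, ⟨?_, fun e => ?_⟩, hopt⟩
    · rw [u2.1 _ (by simp), r5]
      exact hden
    · rw [u2.1 _ (by simp), r5, c2 e e.2, a11, a12]
  · have h0 : σ.reg (k + 13) = 0 := by omega
    rw [h0] at hr
    have hopt := hr.isOptimal_of_zero hBr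
    refine runs_block_wp 10 (fun σ' => Unchanged [5, k + 20, k + 25, k + 26] [] σ σ' ∧
      σ'.reg (k + 25) = 0 ∧ σ'.reg (k + 26) = 1 ∧ σ'.reg 5 = σ.reg (k + 16)) rfl (by omega) ?_ ?_
    · simp [block, wp, wp_mov, Op.eval]
      refine ⟨by omega, by rw [abs_le]; omega, fun h => absurd h (by omega), fun _ => ?_⟩
      refine ⟨by omega, by rw [abs_le]; omega, ?_⟩
      refine Unchanged.setReg ?_ (by simp) _
      refine Unchanged.setReg (Unchanged.setReg ?_ (by simp) _) (by simp) _
      refine Unchanged.setReg (Unchanged.setReg ?_ (by simp) _) (by simp) _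
      exact Unchanged.refl _ _ _
    rintro σ₁ ⟨u1, r25, r26, r5⟩
    have a11 : σ₁.arr (k + 11) = σ.arr (k + 11) := u1.2 _ (by simp)
    have a12 : σ₁.arr (k + 12) = σ.arr (k + 12) := u1.2 _ (by simp)
    refine runs_block_cons (runs_combineLoop hmW hW (saved.unchanged u1 (by simp) (by simp)).m r25
      r26 (fun e he => ?_)) (by omega) ?_
    · rw [a11, a12]
      have b0 := init (by omega) ⟨e, he⟩
      simp only at b0
      obtain ⟨b3, b4⟩ : 0 ≤ σ.arr (k + 12) (e : ℕ) ∧ σ.arr (k + 12) (e : ℕ) ≤ G * Y := hnr ⟨e, he⟩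
      simp only [zero_mul, one_mul, zero_add, abs_zero]
      exact ⟨by omega, by omega, by rw [abs_le]; omega, by rw [abs_le]; omega,
        by rw [abs_le]; omega⟩
    rintro σ₂ ⟨u2, c2⟩
    refine runs_block_nil ⟨_, ⟨?_, fun e => ?_⟩, hopt⟩
    · rw [u2.1 _ (by simp), r5]
      exact hdr0
    · rw [u2.1 _ (by simp), r5, c2 e e.2, a12]
      simp

/-! ### Running time and word size -/

/-- Words of size `(m + M) ^ (30 * w + 17)` suffice: the words of `A` have at most the size
`(m + M) ^ (15 * w)`, and products of two numbers of `A` with a few numbers of the input occur. -/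
theorem Setting.of_bounds {N : BudgetNetwork} {C C₀ U M w : ℕ} (hU : 1 ≤ U) (hM : 2 ≤ M)
    (hcost : ∀ e, |N.cost e| ≤ (C₀ : ℤ)) (hfee : ∀ e, N.fee e ≤ C₀) (hcap : ∀ e, N.cap e ≤ U)
    (hCM : C ≤ M) (hUM : U ≤ M) (hnM : N.n ≤ M) (hBM : N.budget ≤ M) (hC₀ : 1 ≤ C₀) (hC : C₀ ≤ C) :
    Setting N C₀ U (N.m + M) ((N.m + N.n + (2 * N.n * C) ^ 4 + U + 2) ^ w)
      ((N.m + M) ^ (30 * w + 17)) := by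
  have hG : 2 ≤ N.m + M := by omega
  have hG1 : 1 ≤ N.m + M := by omega
  have hbase : 2 * N.n * C ≤ (N.m + M) ^ 3 := by
    calc 2 * N.n * C ≤ (N.m + M) * (N.m + M) * (N.m + M) := by gcongr <;> omega
      _ = _ := by ring
  have hpow : (2 * N.n * C) ^ 4 ≤ (N.m + M) ^ 12 := by
    calc _ ≤ ((N.m + M) ^ 3) ^ 4 := Nat.pow_le_pow_left hbase 4
      _ = _ := by ring
  have hY : N.m + N.n + (2 * N.n * C) ^ 4 + U + 2 ≤ (N.m + M) ^ 15 := by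
    have h1 : N.m + M ≤ (N.m + M) ^ 12 := Nat.le_self_pow (by omega) _
    have h2 : 8 * (N.m + M) ^ 12 ≤ (N.m + M) ^ 15 := by
      calc 8 * (N.m + M) ^ 12 = 2 ^ 3 * (N.m + M) ^ 12 := by norm_num
        _ ≤ (N.m + M) ^ 3 * (N.m + M) ^ 12 := by gcongr
        _ = _ := by ring
    omega
  refine ⟨hC₀, hcost, hfee, hcap, by omega, by omega, by omega, by omega, by omega, hG,
    Nat.one_le_pow _ _ (by omega), ?_, ?_⟩
  · calc (2 * N.n * C₀) ^ 4 ≤ (2 * N.n * C) ^ 4 := by gcongr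
      _ ≤ (N.m + M) ^ 12 := hpow
      _ ≤ _ := Nat.pow_le_pow_right hG1 (by omega)
  · calc (N.m + M) ^ 5 * ((N.m + N.n + (2 * N.n * C) ^ 4 + U + 2) ^ w) ^ 2
        ≤ (N.m + M) ^ 5 * (((N.m + M) ^ 15) ^ w) ^ 2 := by gcongr
      _ = (N.m + M) ^ (30 * w + 5) := by rw [← pow_mul, ← pow_mul, ← pow_add]; congr 1; ring
      _ ≤ _ := Nat.pow_le_pow_right hG1 (by omega)

theorem two_mul_mul_le {n C M : ℕ} (hn : n ≤ M) (hC : C ≤ M) :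
    2 * n * C ≤ 2 ^ (2 * Nat.log 2 M + 3) := by
  have hlt : M < 2 ^ (Nat.log 2 M + 1) := Nat.lt_pow_succ_log_self (by omega) M
  calc 2 * n * C ≤ 2 * 2 ^ (Nat.log 2 M + 1) * 2 ^ (Nat.log 2 M + 1) := by gcongr <;> omega
    _ = _ := by ring

/-- The number of rounds of the search is logarithmic in `M`. -/
theorem gap_le {n C₀ M : ℕ} (hM : 2 ≤ M) (hn : n ≤ M) (hC : C₀ ≤ M) :
    (2 * n * C₀) ^ 3 + 2 ≤ 2 ^ (16 * Nat.log 2 M) := by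
  have hL : 1 ≤ Nat.log 2 M := Nat.log_pos (by omega) hM
  have h1 := two_mul_mul_le hn hC
  have h2 : (2 * n * C₀) ^ 3 ≤ 2 ^ (6 * Nat.log 2 M + 9) := by
    calc _ ≤ (2 ^ (2 * Nat.log 2 M + 3)) ^ 3 := Nat.pow_le_pow_left h1 3
      _ = _ := by rw [← pow_mul]; congr 1; ring
  have h3 : 2 ≤ 2 ^ (6 * Nat.log 2 M + 9) := Nat.le_self_pow (by omega) 2
  calc (2 * n * C₀) ^ 3 + 2 ≤ 2 ^ (6 * Nat.log 2 M + 9 + 1) := by rw [pow_succ 2 (6 * Nat.log 2 M + 9)]; omega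
    _ ≤ _ := Nat.pow_le_pow_right (by omega) (by omega)

/-- The program solves the budget-constrained problem within the stated time. The work besides the
calls of `A` is linear in the number of edges, and hence paid for by the time bound of `A`. -/
theorem solvesBCMCFP_budgetProgram {A : Program} {w : ℕ} {T : ℕ → ℕ → ℕ → ℕ → ℕ}
    (hA : SolvesMCF A w T) :
    SolvesBCMCFP (budgetProgram A A.writeBound) (30 * w + 17)
      (fun m n C U M => 1000 * Nat.log 2 M * T m n ((2 * n * C) ^ 4) U) := by
  intro N C U M hC hU hM hcost hfee hcap hCM hUM hnM hBM σ hσ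
  have hn := Setting.one_le_n N
  have hL : 1 ≤ Nat.log 2 M := Nat.log_pos (by omega) hM
  have hT : N.m + 1 ≤ T N.m N.n ((2 * N.n * C) ^ 4) U :=
    hA.lt_time hn (Nat.one_le_pow _ _ (by positivity)) hU
  have hS := Setting.of_bounds (w := w) hU hM hcost hfee hcap hCM hUM hnM hBM hC le_rfl
  set k := A.writeBound with hk
  suffices h : Runs ((N.m + M) ^ (30 * w + 17)) (budgetProgram A k) σ
      (1000 * Nat.log 2 M * T N.m N.n ((2 * N.n * C) ^ 4) U)
      (fun σ' => ∃ x : Fin N.m → ℝ, Outputs σ' x ∧ N.IsOptimal x) by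
    obtain ⟨σ', τ, he, hτ, x, hx, hopt⟩ := h
    exact ⟨σ', τ, x, he, hτ, hx, hopt⟩
  have hGW : 2 * (N.m + M) ≤ (N.m + M) ^ (30 * w + 17) := by
    calc 2 * (N.m + M) ≤ (N.m + M) * (N.m + M) := by gcongr; omega
      _ = (N.m + M) ^ 2 := by ring
      _ ≤ _ := Nat.pow_le_pow_right (by omega) (by omega)
  have htime : 53 * N.m + 60 + (T N.m N.n ((2 * N.n * C) ^ 4) U + 42 * N.m + 48 + 1) *
      (16 * Nat.log 2 M) + 1 + (10 * N.m + 13)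
      ≤ 1000 * Nat.log 2 M * T N.m N.n ((2 * N.n * C) ^ 4) U := by
    generalize T N.m N.n ((2 * N.n * C) ^ 4) U = t at *
    generalize Nat.log 2 M = L at *
    have h1 : t ≤ L * t := Nat.le_mul_of_pos_left _ hL
    have h2 : (t + 42 * N.m + 48 + 1) * (16 * L) ≤ (50 * t) * (16 * L) :=
      Nat.mul_le_mul_right _ (by omega)
    have h3 : (50 * t) * (16 * L) = 800 * (L * t) := by ring
    have h4 : 1000 * L * t = 1000 * (L * t) := by ring
    omega
  refine Runs.mono ?_ htime (fun _ h => h)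
  refine runs_block_cons (runs_prologue (k := k) hσ hC hcost hfee hcap (by omega : N.n ≤ N.m + M)
    (by omega) (by omega) (by omega) (by omega) hGW hS.pow_le_W) (by omega) ?_
  rintro σ₁ ⟨saved, hinit, C₀, hC₀, hC₀C, hcost₀, hfee₀, r11, r12, r13, r24⟩
  have hS₀ := Setting.of_bounds (w := w) hU hM hcost₀ hfee₀ hcap hCM hUM hnM hBM hC₀ hC₀C
  have hgap := gap_le hM hnM (hC₀C.trans hCM)
  have hgap' : (((2 * N.n * C₀ : ℕ) : ℤ)) ^ 3 + 2 ≤ 2 ^ (16 * Nat.log 2 M) := by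
    exact_mod_cast hgap
  have hN₃ : (0 : ℤ) ≤ ((2 * N.n * C₀ : ℕ) : ℤ) ^ 3 := by positivity
  have hstate : SearchState N k C₀ U ((N.m + N.n + (2 * N.n * C) ^ 4 + U + 2) ^ w)
      (16 * Nat.log 2 M) σ₁ :=
    { saved := saved
      den := r11
      left_ge := by omega
      left_lt := by omega
      right_le := by omega
      gap := by rw [r12, r13]; linarith
      guard := by omega
      left := fun h => absurd h (by omega)
      right := fun h => absurd h (by omega)
      init := fun _ => hinit }
  refine runs_block_cons (runs_loop (SearchState N k C₀ U _) (fun h σ' hσ' hpos =>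
    runs_searchStep hA (by omega) hS₀ hC₀C hU rfl hσ' hpos) hstate) (by omega) ?_
  rintro σ₂ ⟨hg, h', hσ₂⟩
  refine runs_block_cons (runs_epilogue hS₀ hσ₂ hg) (by omega) ?_
  exact fun σ₃ h => runs_block_nil h

theorem SolvesBCMCFP.mono {P : Program} {w : ℕ} {f g : ℕ → ℕ → ℕ → ℕ → ℕ → ℕ}
    (h : SolvesBCMCFP P w f)
    (hfg : ∀ m n C U M, 1 ≤ n → 1 ≤ C → 1 ≤ U → 2 ≤ M → C ≤ M → U ≤ M → n ≤ M →
      f m n C U M ≤ g m n C U M) : SolvesBCMCFP P w g := by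
  intro N C U M hC hU hM hcost hfee hcap hCM hUM hnM hBM σ hσ
  obtain ⟨σ', τ, x, he, hτ, hx⟩ := h N C U M hC hU hM hcost hfee hcap hCM hUM hnM hBM σ hσ
  exact ⟨σ', τ, x, he, hτ.trans (hfg _ _ _ _ _ (Setting.one_le_n N) hC hU hM hCM hUM hnM), hx⟩

theorem log_pow_le {n C M : ℕ} (hn : n ≤ M) (hC : C ≤ M) :
    Nat.log 2 ((2 * n * C) ^ 4) ≤ 8 * Nat.log 2 M + 12 := by
  have h1 := two_mul_mul_le hn hC
  have h2 : (2 * n * C) ^ 4 ≤ 2 ^ (8 * Nat.log 2 M + 12) := by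
    calc _ ≤ (2 ^ (2 * Nat.log 2 M + 3)) ^ 4 := Nat.pow_le_pow_left h1 4
      _ = _ := by rw [← pow_mul]; congr 1; ring
  calc _ ≤ Nat.log 2 (2 ^ (8 * Nat.log 2 M + 12)) := Nat.log_mono_right h2
    _ = _ := Nat.log_pow (by omega) _

/-- A weakly polynomial time bound for minimum cost flows gives one for the budget-constrained
problem. -/
theorem WeaklyPolynomial.exists_bound {T : ℕ → ℕ → ℕ → ℕ → ℕ} (hT : WeaklyPolynomial T) (K : ℕ) :
    ∃ d : ℕ, ∀ m n C U M, 1 ≤ n → 1 ≤ C → 1 ≤ U → 2 ≤ M → C ≤ M → U ≤ M → n ≤ M →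
      K * Nat.log 2 M * T m n ((2 * n * C) ^ 4) U ≤ (m + n + Nat.log 2 M + 2) ^ d := by
  obtain ⟨d, hd⟩ := hT
  refine ⟨K + 1 + 3 * d, fun m n C U M hn hC hU hM hCM hUM hnM => ?_⟩
  have hL : 1 ≤ Nat.log 2 M := Nat.log_pos (by omega) hM
  have h1 := hd m n ((2 * n * C) ^ 4) U hn (Nat.one_le_pow _ _ (by positivity)) hU
  have h2 := log_pow_le hnM hCM
  have h3 : Nat.log 2 U ≤ Nat.log 2 M := Nat.log_mono_right hUM
  obtain ⟨X, hX⟩ : ∃ X, X = m + n + Nat.log 2 M + 2 := ⟨_, rfl⟩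
  have hX4 : 4 ≤ X := by omega
  have h4 : m + n + Nat.log 2 ((2 * n * C) ^ 4) + Nat.log 2 U + 2 ≤ X ^ 3 := by
    have : 16 * X ≤ X ^ 3 := by
      calc 16 * X = 4 * 4 * X := by norm_num
        _ ≤ X * X * X := by gcongr
        _ = _ := by ring
    omega
  rw [← hX]
  calc K * Nat.log 2 M * T m n ((2 * n * C) ^ 4) U
      ≤ X ^ K * X * (X ^ 3) ^ d := by
        gcongr
        · exact (Nat.lt_pow_self (by omega)).le
        · omega
        · exact h1.trans (Nat.pow_le_pow_left h4 d)
    _ = X ^ (K + 1 + 3 * d) := by rw [← pow_mul, pow_add, pow_add, pow_one]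

end BudgetFlow

theorem mainTheorem1 :
    ∃ K κ : ℕ, ∀ (A : BudgetFlow.Program) (w : ℕ) (T : ℕ → ℕ → ℕ → ℕ → ℕ),
      BudgetFlow.SolvesMCF A w T →
      ∃ (P : BudgetFlow.Program) (w' : ℕ),
        BudgetFlow.SolvesBCMCFP P w'
          (fun m n C U M => K * Nat.log 2 M * T m n ((2 * n * C) ^ κ) U) ∧
        (BudgetFlow.LogarithmicInCosts T →
          ∃ K' : ℕ, BudgetFlow.SolvesBCMCFP P w'
            (fun m n C U M => K' * Nat.log 2 M * T m n C U)) ∧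
        (BudgetFlow.WeaklyPolynomial T →
          ∃ d : ℕ, BudgetFlow.SolvesBCMCFP P w'
            (fun m n _ _ M => (m + n + Nat.log 2 M + 2) ^ d)) := by
  -- The exponent is `4` because, with `N₀ = 2 * n * C`, the multipliers have the denominator `N₀ ^ 2`
  -- and numerators up to `N₀ ^ 3`, so that the scaled costs are at most `N₀ ^ 2 * C + N₀ ^ 3 * C`.
  refine ⟨1000, 4, fun A w T hA => ⟨_, _, BudgetFlow.solvesBCMCFP_budgetProgram hA,
    fun hlog => ?_, fun hpoly => ?_⟩⟩
  · obtain ⟨L, hL⟩ := hlog 4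
    refine ⟨1000 * L, (BudgetFlow.solvesBCMCFP_budgetProgram hA).mono
      (fun m n C U M hn hC hU _ _ _ _ => ?_)⟩
    calc 1000 * Nat.log 2 M * T m n ((2 * n * C) ^ 4) U
        ≤ 1000 * Nat.log 2 M * (L * T m n C U) := Nat.mul_le_mul_left _ (hL m n C U hn hC hU)
      _ = _ := by ring
  · obtain ⟨d, hd⟩ := hpoly.exists_bound 1000
    exact ⟨d, (BudgetFlow.solvesBCMCFP_budgetProgram hA).mono hd⟩
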